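/- Let $F:\mathcal C\rightleftarrows\mathcal D:U$ be a Quillen pair between stable model categories with small coproducts (a pointed model category is stable if the suspension functor is an equivalence of its homotopy category, which is then triangulated, with exact triangles given by the cofiber sequences). A set $\mathcal P$ of objects is a set of generators if the only full triangulated subcategory of the homotopy category that is closed under coproducts and contains $\mathcal P$ is the whole homotopy category; an object $X$ is homotopically compact if for every family $\{A_i\}_{i\in I}$ of objects the canonical map $\bigoplus_{i\in I}[X,A_i]\to[X,\coprod_{i\in I}A_i]$ of groups of morphisms in the homotopy category is an isomorphism. Let $\mathcal K$ and $\mathcal L$ be sets of homotopically compact generators of $\mathcal C$ and $\mathcal D$ respectively, and let $LF$ and $RU$ be the total left and right derived functors of $F$ and $U$. 1. $RU:\mathrm{Ho}(\mathcal D)\to\mathrm{Ho}(\mathcal C)$ preserves coproducts if and only if $LF(k)$ is homotopically compact for every $k\in\mathcal K$. 2. Suppose that $RU$ preserves coproducts (equivalently, that $LF$ sends every $k\in\mathcal K$ to a homotopically compact object). Write $Q$ and $R$ for cofibrant and fibrant replacement. If the derived unit $Qk\to U R F Q k$ is a weak equivalence in $\mathcal C$ for every $k\in\mathcal K$, and the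 derived counit $F Q U R l\to R l$ is a weak equivalence in $\mathcal D$ for every $l\in\mathcal L$, then $(F,U)$ is a Quillen equivalence. -/

import Mathlib

open CategoryTheory Limits HomotopicalAlgebra
open scoped DirectSum

universe w v u v' u'

noncomputable section

namespace StableModel

section Homotopy

variable (C : Type u) [Category.{v} C] [ModelCategory C]

/-- The homotopy category of a model category: the localization at the weak equivalences. -/
abbrev Ho := (weakEquivalences C).Localization

/-- The localization functor from a model category to its homotopy category. -/
abbrev toHo : C ⥤ Ho C := (weakEquivalences C).Q

variable {C}

lemma isIso_toHo_map {X Y : C} (f : X ⟶ Y) [WeakEquivalence f] : IsIso ((toHo C).map f) :=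
  Localization.inverts (toHo C) (weakEquivalences C) f (mem_weakEquivalences f)

/-- Ken Brown's lemma: a functor on cofibrant objects which inverts the
trivial cofibrations inverts all weak equivalences. -/
lemma isInvertedBy_of_trivialCofibration {E : Type*} [Category* E] (G : CofibrantObject C ⥤ E)
    (hG : ∀ (X Y : CofibrantObject C) (f : X ⟶ Y), Cofibration f.hom → WeakEquivalence f.hom →
      IsIso (G.map f)) :
    (weakEquivalences (CofibrantObject C)).IsInvertedBy G := by
  intro X Y f hf
  have hw : WeakEquivalence f.hom := by
    rwa [← weakEquivalence_iff_of_objectProperty, weakEquivalence_iff]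
  obtain ⟨h⟩ : Nonempty (CofibrantBrownFactorization f.hom) := inferInstance
  have hZ : IsCofibrant h.Z := isCofibrant_of_cofibration h.i
  let Z : CofibrantObject C := CofibrantObject.mk h.Z
  let i : X ⟶ Z := ⟨h.i⟩
  let p : Z ⟶ Y := ⟨h.p⟩
  let s : Y ⟶ Z := ⟨h.s⟩
  have hi : IsIso (G.map i) := hG _ _ _ (by dsimp [i]; infer_instance) (by dsimp [i]; infer_instance)
  have hs : IsIso (G.map s) := hG _ _ _ (by dsimp [s]; infer_instance) (by dsimp [s]; infer_instance)
  have hsp : s ≫ p = 𝟙 Y := by ext; exact h.s_p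
  have hip : i ≫ p = f := by ext; exact h.fac
  have hp : IsIso (G.map p) := by
    have : IsIso (G.map s ≫ G.map p) := by
      rw [← G.map_comp, hsp, CategoryTheory.Functor.map_id]; infer_instance
    exact IsIso.of_isIso_comp_left (G.map s) (G.map p)
  rw [← hip, G.map_comp]
  infer_instance

/-- The dual statement: a functor on fibrant objects which inverts the
trivial fibrations inverts all weak equivalences. -/
lemma isInvertedBy_of_trivialFibration {E : Type*} [Category* E] (G : FibrantObject C ⥤ E)
    (hG : ∀ (X Y : FibrantObject C) (f : X ⟶ Y), Fibration f.hom → WeakEquivalence f.hom →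
      IsIso (G.map f)) :
    (weakEquivalences (FibrantObject C)).IsInvertedBy G := by
  intro X Y f hf
  have hw : WeakEquivalence f.hom := by
    rwa [← weakEquivalence_iff_of_objectProperty, weakEquivalence_iff]
  obtain ⟨h⟩ : Nonempty (FibrantBrownFactorization f.hom) := inferInstance
  have hZ : IsFibrant h.Z := isFibrant_of_fibration h.p
  let Z : FibrantObject C := FibrantObject.mk h.Z
  let i : X ⟶ Z := ⟨h.i⟩
  let p : Z ⟶ Y := ⟨h.p⟩
  let r : Z ⟶ X := ⟨h.r⟩
  have hp : IsIso (G.map p) := hG _ _ _ (by dsimp [p]; infer_instance) (by dsimp [p]; infer_instance)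
  have hr : IsIso (G.map r) := hG _ _ _ (by dsimp [r]; infer_instance) (by dsimp [r]; infer_instance)
  have hir : i ≫ r = 𝟙 X := by ext; exact h.i_r
  have hip : i ≫ p = f := by ext; exact h.fac
  have hi : IsIso (G.map i) := by
    have : IsIso (G.map i ≫ G.map r) := by
      rw [← G.map_comp, hir, CategoryTheory.Functor.map_id]; infer_instance
    exact IsIso.of_isIso_comp_right (G.map i) (G.map r)
  rw [← hip, G.map_comp]
  infer_instance

end Homotopy

/-- Quotienting `A ⟶ B ⟶ T` by `A` gives a pushout square. -/
lemma isPushout_cokernel_map {C : Type u} [Category.{v} C] [HasZeroMorphisms C] [HasCokernels C]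
    {A B T : C} (i : A ⟶ B) (j : B ⟶ T) (k : A ⟶ T) (hk : k = i ≫ j) :
    IsPushout j (cokernel.π i) (cokernel.π k)
      (cokernel.map i k (𝟙 A) j (by simp [hk])) := by
  subst hk
  refine ⟨⟨by simp⟩, ⟨PushoutCocone.IsColimit.mk _
    (fun s => cokernel.desc _ s.inl (by
      rw [Category.assoc, s.condition, cokernel.condition_assoc, zero_comp])) ?_ ?_ ?_⟩⟩
  · intro s; simp
  · intro s
    rw [← cancel_epi (cokernel.π i)]
    simpa using s.condition
  · intro s m h₁ h₂
    rw [← cancel_epi (cokernel.π (i ≫ j))]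
    simpa using h₁

lemma weakEquivalence_cokernel_map {C : Type u} [Category.{v} C] [ModelCategory C]
    [HasZeroMorphisms C] {A B T : C} (i : A ⟶ B) (j : B ⟶ T) (k : A ⟶ T)
    (hk : k = i ≫ j) [Cofibration j] [WeakEquivalence j] :
    WeakEquivalence (cokernel.map i k (𝟙 A) j (by simp [hk])) := by
  rw [weakEquivalence_iff]
  exact (MorphismProperty.of_isPushout (P := trivialCofibrations C)
    (isPushout_cokernel_map i j k hk).flip (mem_trivialCofibrations j)).2

section Suspension

variable {C : Type u} [Category.{v} C] [ModelCategory C] [HasZeroObject C] [HasZeroMorphisms C]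

open ZeroObject

/-- A factorization of `X ⟶ 0` as a cofibration followed by a trivial fibration. -/
def coneData (X : C) :
    MorphismProperty.MapFactorizationData (cofibrations C) (trivialFibrations C)
      (0 : X ⟶ (0 : C)) :=
  MorphismProperty.factorizationData _ _ _

/-- The cone on `X`: a weakly contractible object containing `X` by a cofibration. -/
abbrev cone (X : C) : C := (coneData X).Z

/-- The inclusion of `X` in its cone. -/
def coneι (X : C) : X ⟶ cone X := (coneData X).i

instance (X : C) : Cofibration (coneι X) := by dsimp only [coneι]; infer_instance

/-- A morphism to zero is a trivial fibration. -/
def IsContractibleFibrant (T : C) : Prop :=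
  Fibration (0 : T ⟶ (0 : C)) ∧ WeakEquivalence (0 : T ⟶ (0 : C))

lemma isContractibleFibrant_cone (X : C) : IsContractibleFibrant (cone X) := by
  have h : (coneData X).p = 0 := (isZero_zero C).eq_of_tgt _ _
  refine ⟨?_, ?_⟩ <;> rw [← h] <;> infer_instance

lemma exists_extension {A B T : C} (i : A ⟶ B) [Cofibration i] (g : A ⟶ T)
    (hT : IsContractibleFibrant T) : ∃ e : B ⟶ T, i ≫ e = g := by
  have := hT.1
  have := hT.2
  have sq : CommSq g i (0 : T ⟶ (0 : C)) 0 := ⟨by simp⟩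
  exact ⟨sq.lift, sq.fac_left⟩

/-- A morphism extended to cones. -/
def coneMap {X Y : C} (f : X ⟶ Y) : cone X ⟶ cone Y :=
  (exists_extension (coneι X) (f ≫ coneι Y) (isContractibleFibrant_cone Y)).choose

lemma coneι_coneMap {X Y : C} (f : X ⟶ Y) : coneι X ≫ coneMap f = f ≫ coneι Y :=
  (exists_extension (coneι X) (f ≫ coneι Y) (isContractibleFibrant_cone Y)).choose_spec

/-- The quotient of the cone on `X` by `X`. -/
abbrev suspObj (X : C) : C := cokernel (coneι X)

/-- The morphism induced by a morphism on the quotients of the cones. -/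
def suspMap {X Y : C} (f : X ⟶ Y) : suspObj X ⟶ suspObj Y :=
  cokernel.map _ _ f (coneMap f) (coneι_coneMap f)

/-- Two extensions of the same morphism to a contractible target agree on quotients
in the homotopy category. -/
lemma toHo_map_cokernel_map_eq {X Y E T : C} (i : X ⟶ E) (t : Y ⟶ T) (f : X ⟶ Y)
    [Cofibration i] (hT : IsContractibleFibrant T) (a b : E ⟶ T)
    (ha : i ≫ a = f ≫ t) (hb : i ≫ b = f ≫ t) :
    (toHo C).map (cokernel.map i t f a ha) = (toHo C).map (cokernel.map i t f b hb) := by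
  let h := MorphismProperty.factorizationData (cofibrations C) (trivialFibrations C)
    (pushout.desc (𝟙 E) (𝟙 E) rfl : pushout i i ⟶ E)
  let j₀ : E ⟶ h.Z := pushout.inl i i ≫ h.i
  let j₁ : E ⟶ h.Z := pushout.inr i i ≫ h.i
  have hj₀ : j₀ ≫ h.p = 𝟙 E := by
    rw [Category.assoc, h.fac, pushout.inl_desc]
  have hj₁ : j₁ ≫ h.p = 𝟙 E := by
    rw [Category.assoc, h.fac, pushout.inr_desc]
  have : Cofibration j₀ := by dsimp [j₀]; infer_instance
  have : WeakEquivalence j₀ := weakEquivalence_of_postcomp_of_fac hj₀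
  have hij : i ≫ j₀ = i ≫ j₁ := by simp [j₀, j₁, pushout.condition_assoc]
  obtain ⟨H, hH⟩ := exists_extension h.i (pushout.desc a b (ha.trans hb.symm)) hT
  have hHa : j₀ ≫ H = a := by
    rw [Category.assoc, hH, pushout.inl_desc]
  have hHb : j₁ ≫ H = b := by
    rw [Category.assoc, hH, pushout.inr_desc]
  let k : X ⟶ h.Z := i ≫ j₀
  let J₀ : cokernel i ⟶ cokernel k := cokernel.map i k (𝟙 X) j₀ (by simp [k])
  let J₁ : cokernel i ⟶ cokernel k := cokernel.map i k (𝟙 X) j₁ (by simp [k, hij])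
  let P : cokernel k ⟶ cokernel i := cokernel.map k i (𝟙 X) h.p (by simp [k, hj₀])
  let K : cokernel k ⟶ cokernel t := cokernel.map k t f H (by simp [k, hHa, ha])
  have hw : WeakEquivalence J₀ := weakEquivalence_cokernel_map i j₀ k rfl
  have h₀ : J₀ ≫ P = 𝟙 _ := by
    rw [← cancel_epi (cokernel.π i)]
    simp [J₀, P, reassoc_of% hj₀]
  have h₁ : J₁ ≫ P = 𝟙 _ := by
    rw [← cancel_epi (cokernel.π i)]
    simp [J₁, P, reassoc_of% hj₁]
  have ea : J₀ ≫ K = cokernel.map i t f a ha := by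
    rw [← cancel_epi (cokernel.π i)]
    simp [J₀, K, reassoc_of% hHa]
  have eb : J₁ ≫ K = cokernel.map i t f b hb := by
    rw [← cancel_epi (cokernel.π i)]
    simp [J₁, K, reassoc_of% hHb]
  have : IsIso ((toHo C).map J₀) := isIso_toHo_map J₀
  have hP : IsIso ((toHo C).map P) := by
    have : IsIso ((toHo C).map J₀ ≫ (toHo C).map P) := by
      rw [← Functor.map_comp, h₀, CategoryTheory.Functor.map_id]; infer_instance
    exact IsIso.of_isIso_comp_left ((toHo C).map J₀) ((toHo C).map P)
  have hJ : (toHo C).map J₀ = (toHo C).map J₁ := by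
    rw [← cancel_mono ((toHo C).map P), ← Functor.map_comp, ← Functor.map_comp, h₀, h₁]
  rw [← ea, ← eb, Functor.map_comp, Functor.map_comp, hJ]

lemma toHo_map_suspMap {X Y : C} (f : X ⟶ Y) (a : cone X ⟶ cone Y)
    (ha : coneι X ≫ a = f ≫ coneι Y) :
    (toHo C).map (suspMap f) = (toHo C).map (cokernel.map _ _ f a ha) :=
  toHo_map_cokernel_map_eq _ _ f (isContractibleFibrant_cone Y) _ _
    (coneι_coneMap f) ha

variable (C) in
/-- The suspension on cofibrant objects, with values in the homotopy category:
`X` is sent to the quotient `cone X / X`, and `f : X ⟶ Y` to the class of the morphism induced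
by any extension of `f` to the cones. -/
def suspCof : CofibrantObject C ⥤ Ho C where
  obj X := (toHo C).obj (suspObj X.obj)
  map f := (toHo C).map (suspMap f.hom)
  map_id X := by
    rw [toHo_map_suspMap _ (𝟙 _) (by simp), ← CategoryTheory.Functor.map_id (toHo C)]
    congr 1
    rw [← cancel_epi (cokernel.π (coneι X.obj))]
    simp
  map_comp {X Y Z} f g := by
    rw [toHo_map_suspMap _ (coneMap f.hom ≫ coneMap g.hom)
      (by simp [coneι_coneMap, reassoc_of% coneι_coneMap f.hom]), ← (toHo C).map_comp]
    congr 1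
    rw [← cancel_epi (cokernel.π (coneι X.obj))]
    simp [suspMap]

lemma isIso_toHo_map_suspMap {X Y : C} (f : X ⟶ Y) [Cofibration f] [WeakEquivalence f] :
    IsIso ((toHo C).map (suspMap f)) := by
  let E := pushout (coneι X) f
  let h := MorphismProperty.factorizationData (trivialCofibrations C) (fibrations C)
    (0 : E ⟶ (0 : C))
  let y : Y ⟶ E := pushout.inr _ _
  let t : Y ⟶ h.Z := y ≫ h.i
  have : Cofibration y := by dsimp [y, E]; infer_instance
  have : Cofibration t := by dsimp [t]; infer_instance
  let c : cone X ⟶ h.Z := pushout.inl _ _ ≫ h.i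
  have : WeakEquivalence (pushout.inl (coneι X) f) := inferInstance
  have : WeakEquivalence c := by dsimp only [c]; infer_instance
  have hp : h.p = 0 := (isZero_zero C).eq_of_tgt _ _
  have hZ : IsContractibleFibrant h.Z := by
    refine ⟨by rw [← hp]; infer_instance, ?_⟩
    have := (isContractibleFibrant_cone X).2
    exact weakEquivalence_of_precomp_of_fac (f := c) (g := 0) (fg := 0) (by simp)
  have hc : coneι X ≫ c = f ≫ t := by
    simp [c, t, y, E, pushout.condition_assoc]
  obtain ⟨r, hr⟩ := exists_extension t (coneι Y) (isContractibleFibrant_cone Y)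
  obtain ⟨s, hs⟩ := exists_extension (coneι Y) t hZ
  let φ : suspObj X ⟶ cokernel t := cokernel.map _ _ f c hc
  let R : cokernel t ⟶ suspObj Y := cokernel.map _ _ (𝟙 Y) r (by simp [hr])
  let S : suspObj Y ⟶ cokernel t := cokernel.map _ _ (𝟙 Y) s (by simp [hs])
  have hR : IsIso ((toHo C).map R) := by
    refine ⟨(toHo C).map S, ?_, ?_⟩
    · have e : R ≫ S = cokernel.map t t (𝟙 Y) (r ≫ s) (by simp [reassoc_of% hr, hs]) := by
        rw [← cancel_epi (cokernel.π t)]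
        simp [R, S]
      rw [← Functor.map_comp, e,
        toHo_map_cokernel_map_eq t t (𝟙 Y) hZ (r ≫ s) (𝟙 _) _ (by simp), ← CategoryTheory.Functor.map_id]
      congr 1
      rw [← cancel_epi (cokernel.π t)]
      simp
    · have e : S ≫ R = cokernel.map (coneι Y) (coneι Y) (𝟙 Y) (s ≫ r)
          (by simp [reassoc_of% hs, hr]) := by
        rw [← cancel_epi (cokernel.π (coneι Y))]
        simp [R, S]
      rw [← Functor.map_comp, e,
        toHo_map_cokernel_map_eq (coneι Y) (coneι Y) (𝟙 Y) (isContractibleFibrant_cone Y)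
          (s ≫ r) (𝟙 _) _ (by simp), ← CategoryTheory.Functor.map_id]
      congr 1
      rw [← cancel_epi (cokernel.π (coneι Y))]
      simp
  have hφ : IsIso ((toHo C).map φ) := by
    let φ₁ : suspObj X ⟶ cokernel y :=
      cokernel.map _ _ f (pushout.inl _ _) pushout.condition
    let φ₂ : cokernel y ⟶ cokernel t := cokernel.map y t (𝟙 Y) h.i (by simp [t])
    have h₁ : IsIso φ₁ :=
      isIso_cokernel_map_of_isPushout (IsPushout.of_hasPushout (coneι X) f)
    have h₂ : WeakEquivalence φ₂ := weakEquivalence_cokernel_map y h.i t rfl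
    have := isIso_toHo_map φ₂
    have e : φ = φ₁ ≫ φ₂ := by
      rw [← cancel_epi (cokernel.π (coneι X))]
      simp [φ, φ₁, φ₂, c]
    rw [e, Functor.map_comp]
    infer_instance
  have e : φ ≫ R = cokernel.map _ _ f (c ≫ r) (by rw [reassoc_of% hc, hr]) := by
    rw [← cancel_epi (cokernel.π (coneι X))]
    simp [φ, R]
  rw [toHo_map_suspMap f (c ≫ r) (by rw [reassoc_of% hc, hr])]
  have e' := congrArg (toHo C).map e
  rw [Functor.map_comp] at e'
  exact e' ▸ inferInstance

variable (C) in
lemma suspCof_inverts : (weakEquivalences (CofibrantObject C)).IsInvertedBy (suspCof C) :=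
  isInvertedBy_of_trivialCofibration _ (fun _ _ f _ _ => isIso_toHo_map_suspMap f.hom)

variable (C) in
/-- The suspension functor on the homotopy category of a pointed model category, induced by
`X ↦ cone X / X` on cofibrant objects. -/
def suspension : Ho C ⥤ Ho C :=
  Localization.lift (suspCof C) (suspCof_inverts C) (CofibrantObject.ι ⋙ toHo C)

variable (C) in
/-- A pointed model category is stable if the suspension functor is an equivalence on the
homotopy category. -/
class IsStable : Prop where
  isEquivalence_suspension : (suspension C).IsEquivalence

/-- A pair of composable morphisms of the homotopy category is a cofiber sequence if it is
isomorphic to `A ⟶ B ⟶ B / A` for a cofibration `A ⟶ B` between cofibrant objects. Up to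
isomorphism the exact triangles of the homotopy category of a stable model category are
these sequences, prolonged by a boundary morphism to the suspension of `A`. -/
def IsCofiberSequence {X Y Z : Ho C} (f : X ⟶ Y) (g : Y ⟶ Z) : Prop :=
  ∃ (A B : C) (i : A ⟶ B) (_ : IsCofibrant A) (_ : Cofibration i)
    (a : X ≅ (toHo C).obj A) (b : Y ≅ (toHo C).obj B) (c : Z ≅ (toHo C).obj (cokernel i)),
    f ≫ b.hom = a.hom ≫ (toHo C).map i ∧
      g ≫ c.hom = b.hom ≫ (toHo C).map (cokernel.π i)

/-- A full subcategory of the homotopy category, given by its class of objects, is localising if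
it is a triangulated subcategory which is closed under coproducts. (The
boundary morphism of an exact triangle plays no role in this condition.) -/
structure IsLocalising (P : ObjectProperty (Ho C)) : Prop where
  zero : ∀ X, IsZero X → P X
  suspension_iff : ∀ X, P ((suspension C).obj X) ↔ P X
  two_of_three₁ : ∀ {X Y Z : Ho C} (f : X ⟶ Y) (g : Y ⟶ Z), IsCofiberSequence f g →
    P Y → P Z → P X
  two_of_three₂ : ∀ {X Y Z : Ho C} (f : X ⟶ Y) (g : Y ⟶ Z), IsCofiberSequence f g →
    P X → P Z → P Y
  two_of_three₃ : ∀ {X Y Z : Ho C} (f : X ⟶ Y) (g : Y ⟶ Z), IsCofiberSequence f g →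
    P X → P Y → P Z
  coproduct : ∀ (I : Type w), P.IsClosedUnderColimitsOfShape (Discrete I)

/-- A set of objects of a stable model category is a set of generators if the only localising
subcategory of the homotopy category that contains it is the whole homotopy category. -/
def IsGeneratingSet (K : Set C) : Prop :=
  ∀ P : ObjectProperty (Ho C), IsLocalising.{w} P → (∀ k ∈ K, P ((toHo C).obj k)) → ∀ X, P X

end Suspension

section Compact

variable {T : Type u} [Category.{v} T]

open Classical in
/-- The canonical map from the direct sum of the groups of morphisms `X ⟶ A i` to the group of
morphisms from `X` to a coproduct (more generally, to the point of a cofan) of the `A i`. -/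
def directSumToHom [Preadditive T] (X : T) {I : Type w} {A : I → T} (c : Cofan A) :
    (⨁ i, (X ⟶ A i)) →+ (X ⟶ c.pt) :=
  DirectSum.toAddMonoid (fun i => Preadditive.rightComp X (c.inj i))

/-- An object of a preadditive category is compact if morphisms from it to any coproduct are the
direct sum of the morphisms to the summands. -/
def IsCompactObject [Preadditive T] (X : T) : Prop :=
  ∀ (I : Type w) (A : I → T) (c : Cofan A), IsColimit c →
    Function.Bijective (directSumToHom X c)

end Compact

/-- An object of a stable model category is homotopically compact if it is compact in the
homotopy category. The homotopy category of a stable model category is additive in exactly one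
way, so that the quantifier over the preadditive structures ranges over one structure only. -/
def IsHomotopicallyCompact {C : Type u} [Category.{v} C] [ModelCategory C] (X : Ho C) : Prop :=
  ∀ _ : Preadditive (Ho C), IsCompactObject.{w} X

section Quillen

variable {C : Type u} [Category.{v} C] [ModelCategory C]
  {D : Type u'} [Category.{v'} D] [ModelCategory D] {F : C ⥤ D} {U : D ⥤ C}

/-- An adjunction `F ⊣ U` between model categories is a Quillen pair if `F` preserves
cofibrations and trivial cofibrations. -/
structure IsQuillenPair (_adj : F ⊣ U) : Prop where
  cofibration_map : ∀ {X Y : C} (f : X ⟶ Y), Cofibration f → Cofibration (F.map f)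
  weakEquivalence_map : ∀ {X Y : C} (f : X ⟶ Y), Cofibration f → WeakEquivalence f →
    WeakEquivalence (F.map f)

/-- A Quillen pair `F ⊣ U` is a Quillen equivalence if, for `X` cofibrant and `Y` fibrant,
a morphism `F X ⟶ Y` is a weak equivalence if and only if its adjunct `X ⟶ U Y` is one. -/
structure IsQuillenEquivalence (adj : F ⊣ U) : Prop where
  isQuillenPair : IsQuillenPair adj
  weakEquivalence_iff : ∀ (X : C) (Y : D), IsCofibrant X → IsFibrant Y → ∀ f : F.obj X ⟶ Y,
    WeakEquivalence f ↔ WeakEquivalence (adj.homEquiv X Y f)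

variable {adj : F ⊣ U}

lemma IsQuillenPair.map_trivialFibration (h : IsQuillenPair adj) {X Y : D} (f : X ⟶ Y)
    [Fibration f] [WeakEquivalence f] : WeakEquivalence (U.map f) := by
  have : trivialFibrations C (U.map f) := by
    rw [← cofibrations_rlp]
    intro A B i hi
    rw [← cofibration_iff] at hi
    rw [← adj.hasLiftingProperty_iff]
    have := h.cofibration_map i hi
    infer_instance
  exact ((mem_trivialFibrations_iff _).1 this).2

lemma IsQuillenPair.left_inverts (h : IsQuillenPair adj) :
    (weakEquivalences (CofibrantObject C)).IsInvertedBy (CofibrantObject.ι ⋙ F ⋙ toHo D) :=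
  isInvertedBy_of_trivialCofibration _ (fun X Y f hf hw => by
    have := h.weakEquivalence_map f.hom hf hw
    exact isIso_toHo_map (F.map f.hom))

lemma IsQuillenPair.right_inverts (h : IsQuillenPair adj) :
    (weakEquivalences (FibrantObject D)).IsInvertedBy (FibrantObject.ι ⋙ U ⋙ toHo C) :=
  isInvertedBy_of_trivialFibration _ (fun X Y f hf hw => by
    have := h.map_trivialFibration f.hom
    exact isIso_toHo_map (U.map f.hom))

/-- The total left derived functor of the left adjoint of a Quillen pair, which is given by `F`
on cofibrant objects. -/
def IsQuillenPair.leftDerived (h : IsQuillenPair adj) : Ho C ⥤ Ho D :=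
  Localization.lift (CofibrantObject.ι ⋙ F ⋙ toHo D) h.left_inverts
    (CofibrantObject.ι ⋙ toHo C)

/-- The total right derived functor of the right adjoint of a Quillen pair, which is given by `U`
on fibrant objects. -/
def IsQuillenPair.rightDerived (h : IsQuillenPair adj) : Ho D ⥤ Ho C :=
  Localization.lift (FibrantObject.ι ⋙ U ⋙ toHo C) h.right_inverts
    (FibrantObject.ι ⋙ toHo D)

/-- Cofibrant replacement `cofRep X`, with its trivial fibration `cofRepHom X : cofRep X ⟶ X`. -/
abbrev cofRep (X : C) : C := CofibrantObject.HoCat.resolutionObj X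

/-- The trivial fibration from the cofibrant replacement. -/
abbrev cofRepHom (X : C) : cofRep X ⟶ X := CofibrantObject.HoCat.pResolutionObj X

/-- Fibrant replacement `fibRep X`, with its trivial cofibration `fibRepHom X : X ⟶ fibRep X`. -/
abbrev fibRep (X : C) : C := FibrantObject.HoCat.resolutionObj X

/-- The trivial cofibration to the fibrant replacement. -/
abbrev fibRepHom (X : C) : X ⟶ fibRep X := FibrantObject.HoCat.iResolutionObj X

/-- The derived unit `Q A ⟶ U R F Q A`, where `Q` and `R` are the cofibrant and fibrant
replacements. -/
def derivedUnit (adj : F ⊣ U) (A : C) : cofRep A ⟶ U.obj (fibRep (F.obj (cofRep A))) :=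
  adj.unit.app (cofRep A) ≫ U.map (fibRepHom (F.obj (cofRep A)))

/-- The derived counit `F Q U R B ⟶ R B`. -/
def derivedCounit (adj : F ⊣ U) (B : D) : F.obj (cofRep (U.obj (fibRep B))) ⟶ fibRep B :=
  F.map (cofRepHom (U.obj (fibRep B))) ≫ adj.counit.app (fibRep B)

end Quillen

/-- A functor preserves coproducts (indexed by types of the universe `w`). -/
def PreservesCoproducts {T : Type u} [Category.{v} T] {T' : Type u'} [Category.{v'} T']
    (G : T ⥤ T') : Prop :=
  ∀ I : Type w, PreservesColimitsOfShape (Discrete I) G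

end StableModel

end

/-!
On `Ho C` the morphisms out of a suspension are the edges of a groupoid: glue several cones along
their common base, and collapse any one of them. By stability every object is a suspension and
every morphism between suspensions is the suspension of a morphism, so these groups give a bilinear
composition, and bilinearity makes them commutative. A cofiber sequence is a sequence of weak
cokernels, and by stability one of weak kernels, so that the five lemma applies to it.

For `B : I → Ho D` and `X` compact with compact image, both sides of
`[X, ∐ RU (B i)] ⟶ [X, RU (∐ B i)] ≅ [LF X, ∐ B i]` are `⨁ [LF X, B i]`. Hence the comparison
morphism is detected as an isomorphism by the generators and their suspensions. If `RU` preserves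
coproducts, the objects at which the derived unit is an isomorphism form a localising subcategory.
Once the unit is an isomorphism, the counit is inverted by `[LF S, -]` for every `S`, and the image
of `LF` contains the generators of `Ho D`, at which the counit is an isomorphism.
-/

noncomputable section

namespace StableModel

section HomotopyCategory

variable {C : Type u} [Category.{v} C] [ModelCategory C]

lemma exists_iso_toHo_obj (X : Ho C) :
    ∃ (A : C) (_ : IsCofibrant A) (_ : IsFibrant A), Nonempty (X ≅ (toHo C).obj A) := by
  let A := (toHo C).objPreimage X
  let Q := cofRep A
  have := isIso_toHo_map (cofRepHom A)
  have := isIso_toHo_map (fibRepHom Q)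
  exact ⟨fibRep Q, isCofibrant_of_cofibration (fibRepHom Q), inferInstance,
    ⟨((toHo C).objObjPreimageIso X).symm ≪≫ (asIso ((toHo C).map (cofRepHom A))).symm ≪≫
      asIso ((toHo C).map (fibRepHom Q))⟩⟩

lemma exists_toHo_map_eq {A B : C} [IsCofibrant A] [IsFibrant B]
    (f : (toHo C).obj A ⟶ (toHo C).obj B) : ∃ g : A ⟶ B, (toHo C).map g = f :=
  map_surjective_of_isLocalization (toHo C) A B f

lemma exists_extension_of_toHo_map_eq {A X B : C} [IsCofibrant A] [IsFibrant B] (i : A ⟶ X)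
    [Cofibration i] (l : X ⟶ B) (f : A ⟶ B) (h : (toHo C).map (i ≫ l) = (toHo C).map f) :
    ∃ l' : X ⟶ B, i ≫ l' = f ∧ (toHo C).map l' = (toHo C).map l := by
  rw [← RightHomotopyRel.iff_map_eq (toHo C) A B] at h
  obtain ⟨P, _, ⟨h⟩⟩ := h.exists_good_pathObject
  obtain ⟨l', h', e⟩ := h.homotopy_extension i l
  refine ⟨l', ?_, ?_⟩
  · rw [← h'.h₁, reassoc_of% e, h.h₁]
  · exact ((RightHomotopyRel.factorsThroughLocalization C h'.rightHomotopyRel).map_eq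
      (toHo C)).symm

lemma exists_lift_of_toHo_map_eq {A X B : C} [IsCofibrant A] [IsFibrant B]
    (p : X ⟶ B) [Fibration p] (l : A ⟶ X) (f : A ⟶ B)
    (h : (toHo C).map (l ≫ p) = (toHo C).map f) :
    ∃ l' : A ⟶ X, l' ≫ p = f ∧ (toHo C).map l' = (toHo C).map l := by
  rw [← LeftHomotopyRel.iff_map_eq (toHo C) A B] at h
  obtain ⟨P, _, ⟨h⟩⟩ := h.exists_good_cylinder
  have sq : CommSq l P.i₀ p h.h := ⟨h.h₀.symm⟩
  refine ⟨P.i₁ ≫ sq.lift, by rw [Category.assoc, sq.fac_right, h.h₁], ?_⟩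
  have h' : P.LeftHomotopy l (P.i₁ ≫ sq.lift) := { h := sq.lift, h₀ := sq.fac_left, h₁ := rfl }
  exact ((LeftHomotopyRel.factorsThroughLocalization C ⟨P, ⟨h'⟩⟩).map_eq (toHo C)).symm

lemma isIso_toHo_map_iff_of_commSq {X Y X' Y' : C} {a : X ⟶ X'} {f : X ⟶ Y} {f' : X' ⟶ Y'}
    {b : Y ⟶ Y'} (sq : CommSq a f f' b) [WeakEquivalence a] [WeakEquivalence b] :
    IsIso ((toHo C).map f) ↔ IsIso ((toHo C).map f') := by
  have := isIso_toHo_map a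
  have := isIso_toHo_map b
  rw [← isIso_comp_right_iff _ ((toHo C).map b), ← isIso_comp_left_iff ((toHo C).map a),
    ← Functor.map_comp, ← Functor.map_comp, sq.w]

lemma weakEquivalence_of_toHo_map_eq_id {Z : C} [IsCofibrant Z] [IsFibrant Z] (f : Z ⟶ Z)
    (h : (toHo C).map f = 𝟙 _) : WeakEquivalence f := by
  rw [← (toHo C).map_id, ← RightHomotopyRel.iff_map_eq (toHo C) Z Z] at h
  obtain ⟨P, ⟨h⟩⟩ := h
  rw [h.weakEquivalence_iff]
  infer_instance

lemma weakEquivalence_of_fibration_of_isIso_toHo_map {X Y : C} [IsCofibrant X] [IsCofibrant Y]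
    [IsFibrant Y] (p : X ⟶ Y) [Fibration p] [IsIso ((toHo C).map p)] : WeakEquivalence p := by
  have : IsFibrant X := isFibrant_of_fibration p
  obtain ⟨s₀, hs₀⟩ := exists_toHo_map_eq (inv ((toHo C).map p))
  obtain ⟨s, hsp, hs⟩ := exists_lift_of_toHo_map_eq p s₀ (𝟙 Y) (by
    rw [Functor.map_comp, hs₀, IsIso.inv_hom_id, CategoryTheory.Functor.map_id])
  -- The strict section `s` exhibits `p` as a retract of `p ≫ s`, which is homotopic to `𝟙 X`.
  have hps : WeakEquivalence (p ≫ s) := weakEquivalence_of_toHo_map_eq_id _ (by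
    rw [Functor.map_comp, hs, hs₀, IsIso.hom_inv_id])
  rw [weakEquivalence_iff] at hps ⊢
  refine MorphismProperty.of_retract (P := weakEquivalences C) (f := p) (g := p ≫ s) ?_ hps
  exact
    { i := Arrow.homMk (𝟙 _) s (by simp)
      r := Arrow.homMk (𝟙 _) p (by simp [hsp])
      retract := by ext <;> simp [hsp] }

lemma weakEquivalence_of_isIso_toHo_map_of_isFibrant {X Y : C} [IsCofibrant X] [IsCofibrant Y]
    [IsFibrant Y] (f : X ⟶ Y) [IsIso ((toHo C).map f)] : WeakEquivalence f := by
  let d := MorphismProperty.factorizationData (trivialCofibrations C) (fibrations C) f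
  have : IsCofibrant d.Z := isCofibrant_of_cofibration d.i
  have : IsIso ((toHo C).map d.p) :=
    (isIso_toHo_map_iff_of_commSq (a := d.i) (f := f) (b := 𝟙 Y) ⟨by simp⟩).1 inferInstance
  have := weakEquivalence_of_fibration_of_isIso_toHo_map d.p
  rw [← d.fac]
  infer_instance

lemma weakEquivalence_of_isIso_toHo_map {X Y : C} (f : X ⟶ Y) [IsIso ((toHo C).map f)] :
    WeakEquivalence f := by
  wlog hXY : IsCofibrant X ∧ IsCofibrant Y generalizing X Y
  · have _ : IsIso ((toHo C).map (CofibrantObject.HoCat.resolutionMap f)) :=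
      (isIso_toHo_map_iff_of_commSq ⟨(CofibrantObject.HoCat.resolutionMap_fac f).symm⟩).2
        inferInstance
    rw [← CofibrantObject.HoCat.weakEquivalence_resolutionMap_iff]
    exact this (CofibrantObject.HoCat.resolutionMap f) ⟨inferInstance, inferInstance⟩
  obtain ⟨_, _⟩ := hXY
  have : IsIso ((toHo C).map (FibrantObject.HoCat.resolutionMap f)) :=
    (isIso_toHo_map_iff_of_commSq ⟨FibrantObject.HoCat.resolutionMap_fac f⟩).1 inferInstance
  rw [← FibrantObject.HoCat.weakEquivalence_resolutionMap_iff]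
  exact weakEquivalence_of_isIso_toHo_map_of_isFibrant _

lemma isIso_toHo_map_iff {X Y : C} (f : X ⟶ Y) :
    IsIso ((toHo C).map f) ↔ WeakEquivalence f :=
  ⟨fun _ => weakEquivalence_of_isIso_toHo_map f, fun _ => isIso_toHo_map f⟩

lemma isCofibrant_of_isZero {Z : C} (hZ : IsZero Z) : IsCofibrant Z := by
  have : IsIso (initial.to Z) := ⟨hZ.to_ _, Subsingleton.elim _ _, hZ.eq_of_src _ _⟩
  infer_instance

lemma isFibrant_of_isZero {Z : C} (hZ : IsZero Z) : IsFibrant Z := by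
  have : IsIso (terminal.from Z) := ⟨hZ.from_ _, hZ.eq_of_src _ _, Subsingleton.elim _ _⟩
  infer_instance

lemma isZero_toHo_obj {Z : C} (hZ : IsZero Z) : IsZero ((toHo C).obj Z) := by
  have := isCofibrant_of_isZero hZ
  have := isFibrant_of_isZero hZ
  constructor <;> intro Y <;> obtain ⟨A, _, _, ⟨e⟩⟩ := exists_iso_toHo_obj Y
  · refine ⟨⟨⟨(toHo C).map (hZ.to_ A) ≫ e.inv⟩, fun f => ?_⟩⟩
    obtain ⟨g, hg⟩ := exists_toHo_map_eq (f ≫ e.hom)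
    change f = _ ≫ e.inv
    rw [Iso.eq_comp_inv, ← hg, hZ.eq_of_src g (hZ.to_ A)]
  · refine ⟨⟨⟨e.hom ≫ (toHo C).map (hZ.from_ A)⟩, fun f => ?_⟩⟩
    obtain ⟨g, hg⟩ := exists_toHo_map_eq (e.inv ≫ f)
    change f = e.hom ≫ _
    rw [← Iso.inv_comp_eq, ← hg, hZ.eq_of_tgt g (hZ.from_ A)]

instance [HasZeroObject C] : HasZeroObject (Ho C) :=
  ⟨(toHo C).obj _, isZero_toHo_obj (isZero_zero C)⟩

end HomotopyCategory

section Coproducts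

variable {C : Type u} [Category.{v} C] [ModelCategory C] {I : Type w} {X : I → C}

lemma isCofibrant_cofan_pt (hX : ∀ i, IsCofibrant (X i)) {c : Cofan X} (hc : IsColimit c) :
    IsCofibrant c.pt := by
  rw [isCofibrant_iff, cofibration_iff, ← trivialFibrations_llp]
  intro A B p hp
  obtain ⟨_, _⟩ := (mem_trivialFibrations_iff _).1 hp
  refine ⟨fun {f g} _ => ?_⟩
  have sq (i : I) : CommSq (initial.to A) (initial.to (X i)) p (c.inj i ≫ g) := ⟨by simp⟩
  refine ⟨⟨⟨Cofan.IsColimit.desc hc (fun i => (sq i).lift), Subsingleton.elim _ _, ?_⟩⟩⟩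
  refine Cofan.IsColimit.hom_ext hc _ _ (fun i => ?_)
  rw [Cofan.IsColimit.fac_assoc, (sq i).fac_right]

lemma toHo_map_eq_of_isColimit_cofan (hX : ∀ i, IsCofibrant (X i)) {c : Cofan X}
    (hc : IsColimit c) {T : C} [IsFibrant T] {g g' : c.pt ⟶ T}
    (h : ∀ i, (toHo C).map (c.inj i ≫ g) = (toHo C).map (c.inj i ≫ g')) :
    (toHo C).map g = (toHo C).map g' := by
  have := isCofibrant_cofan_pt hX hc
  obtain ⟨P, _⟩ := PathObject.exists_very_good T
  have H (i : I) : P.RightHomotopy (c.inj i ≫ g) (c.inj i ≫ g') :=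
    RightHomotopyRel.rightHomotopy ((RightHomotopyRel.iff_map_eq (toHo C) _ _).2 (h i)) P
  rw [← RightHomotopyRel.iff_map_eq (toHo C)]
  refine ⟨P, ⟨{ h := Cofan.IsColimit.desc hc (fun i => (H i).h), h₀ := ?_, h₁ := ?_ }⟩⟩ <;>
    refine Cofan.IsColimit.hom_ext hc _ _ (fun i => ?_) <;> rw [Cofan.IsColimit.fac_assoc]
  exacts [(H i).h₀, (H i).h₁]

lemma existsUnique_toHo_cofan_desc (hX : ∀ i, IsCofibrant (X i)) {c : Cofan X}
    (hc : IsColimit c) (T : Ho C) (f : ∀ i, (toHo C).obj (X i) ⟶ T) :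
    ∃! g : (toHo C).obj c.pt ⟶ T, ∀ i, (toHo C).map (c.inj i) ≫ g = f i := by
  have := isCofibrant_cofan_pt hX hc
  obtain ⟨A, _, _, ⟨e⟩⟩ := exists_iso_toHo_obj T
  choose f' hf' using fun i => exists_toHo_map_eq (f i ≫ e.hom)
  refine ⟨(toHo C).map (Cofan.IsColimit.desc hc f') ≫ e.inv, fun i => ?_, fun g hg => ?_⟩
  · simp only [← Functor.map_comp_assoc, Cofan.IsColimit.fac, hf', Category.assoc,
      Iso.hom_inv_id, Category.comp_id]
  · obtain ⟨g', hg'⟩ := exists_toHo_map_eq (g ≫ e.hom)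
    rw [Iso.eq_comp_inv, ← hg']
    refine toHo_map_eq_of_isColimit_cofan hX hc (fun i => ?_)
    rw [Functor.map_comp, hg', ← Category.assoc, hg, Cofan.IsColimit.fac, hf']

lemma nonempty_isColimit_toHo_cofan (hX : ∀ i, IsCofibrant (X i)) {c : Cofan X}
    (hc : IsColimit c) :
    Nonempty (IsColimit (Cofan.mk ((toHo C).obj c.pt) (fun i => (toHo C).map (c.inj i)))) :=
  have key (s : Cofan fun i => (toHo C).obj (X i)) :=
    existsUnique_toHo_cofan_desc hX hc s.pt s.inj
  ⟨Cofan.IsColimit.mk _ (fun s => (key s).choose) (fun s => (key s).choose_spec.1)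
    (fun s m hm => (key s).choose_spec.2 m hm)⟩

instance [HasCoproducts.{w} C] : HasCoproducts.{w} (Ho C) := by
  intro I
  have (X : I → Ho C) : HasColimit (Discrete.functor X) := by
    choose A hA _ e using fun i => exists_iso_toHo_obj (X i)
    obtain ⟨h⟩ := nonempty_isColimit_toHo_cofan hA (coproductIsCoproduct A)
    have : HasColimit (Discrete.functor fun i => (toHo C).obj (A i)) := ⟨_, h⟩
    exact hasColimit_of_iso (F := Discrete.functor fun i => (toHo C).obj (A i))
      (Discrete.natIso (fun i => (e i.as).some))
  exact ⟨fun F => hasColimit_of_iso (Discrete.natIsoFunctor (F := F))⟩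

end Coproducts

section CollapsingContractible

lemma isPushout_cokernel_π_coprod_inr {C : Type u} [Category.{v} C] [HasZeroMorphisms C]
    {W V Z : C} [HasBinaryCoproduct W V] (m : W ⨿ V ⟶ Z) [HasCokernel (coprod.inr ≫ m)] :
    IsPushout m (coprod.desc (𝟙 W) 0) (cokernel.π (coprod.inr ≫ m))
      (coprod.inl ≫ m ≫ cokernel.π (coprod.inr ≫ m)) := by
  have condition_inl (s : PushoutCocone m (coprod.desc (𝟙 W) 0)) :
      coprod.inl ≫ m ≫ s.inl = s.inr := by
    rw [s.condition, coprod.inl_desc_assoc, Category.id_comp]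
  have condition_inr (s : PushoutCocone m (coprod.desc (𝟙 W) 0)) :
      (coprod.inr ≫ m) ≫ s.inl = 0 := by
    rw [Category.assoc, s.condition, coprod.inr_desc_assoc, zero_comp]
  refine ⟨⟨?_⟩, ⟨PushoutCocone.IsColimit.mk _ (fun s => cokernel.desc _ s.inl (condition_inr s))
    (fun s => by simp) (fun s => by simpa using condition_inl s) (fun s m' h _ => ?_)⟩⟩
  · apply coprod.hom_ext
    · rw [coprod.inl_desc_assoc, Category.id_comp]
    · rw [coprod.inr_desc_assoc, zero_comp, ← Category.assoc, cokernel.condition]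
  · rw [← cancel_epi (cokernel.π (coprod.inr ≫ m))]
    simpa using h

variable {C : Type u} [Category.{v} C] [ModelCategory C]

lemma weakEquivalence_coprod_inl (W V : C) [IsCofibrant V] [WeakEquivalence (initial.to V)] :
    WeakEquivalence (coprod.inl : W ⟶ W ⨿ V) := by
  rw [weakEquivalence_iff]
  exact (MorphismProperty.of_isPushout (P := trivialCofibrations C)
    (IsPushout.of_isColimit_binaryCofan_of_isInitial
      (colimit.isColimit (pair W V)) initialIsInitial).flip
    (mem_trivialCofibrations (initial.to V))).2

lemma weakEquivalence_coprod_inl_comp_cokernel_π [HasZeroMorphisms C] {W V Z : C}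
    (m : W ⨿ V ⟶ Z) [Cofibration m] [WeakEquivalence m] :
    WeakEquivalence (coprod.inl ≫ m ≫ cokernel.π (coprod.inr ≫ m)) := by
  rw [weakEquivalence_iff]
  exact (MorphismProperty.of_isPushout (P := trivialCofibrations C)
    (isPushout_cokernel_π_coprod_inr m).flip (mem_trivialCofibrations m)).2

open ZeroObject

variable [HasZeroObject C] [HasZeroMorphisms C]

lemma weakEquivalence_initial_to {V : C} (hV : WeakEquivalence (0 : V ⟶ (0 : C))) :
    WeakEquivalence (initial.to V) := by
  have h₀ : IsZero (⊥_ C) := (isZero_zero C).of_iso HasZeroObject.zeroIsoInitial.symm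
  have : IsIso (0 : (⊥_ C) ⟶ (0 : C)) := ⟨0, h₀.eq_of_src _ _, (isZero_zero C).eq_of_src _ _⟩
  exact weakEquivalence_of_postcomp_of_fac (f := initial.to V) (g := (0 : V ⟶ (0 : C)))
    (fg := 0) (by simp)

-- The quotient of a cylinder of `W` by the copy of `V` at one end is weakly equivalent to `W`
-- through the other end, and to `W / V` through the projection.
lemma weakEquivalence_cokernel_π {V W : C} (j : V ⟶ W) [IsCofibrant V] [Cofibration j]
    (hV : WeakEquivalence (0 : V ⟶ (0 : C))) : WeakEquivalence (cokernel.π j) := by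
  have := weakEquivalence_initial_to hV
  have := weakEquivalence_coprod_inl W V
  have : IsCofibrant W := isCofibrant_of_cofibration j
  obtain ⟨P, _⟩ := Cylinder.exists_very_good W
  let m : W ⨿ V ⟶ P.I := coprod.map (𝟙 W) j ≫ P.i
  have hm₀ : coprod.inl ≫ m = P.i₀ := by simp [m]
  have hm₁ : coprod.inr ≫ m = j ≫ P.i₁ := by simp [m]
  have : WeakEquivalence m := weakEquivalence_of_precomp_of_fac hm₀
  let k : V ⟶ P.I := coprod.inr ≫ m
  let J : cokernel j ⟶ cokernel k := cokernel.map j k (𝟙 V) P.i₁ (by simp [k, hm₁])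
  let p : cokernel k ⟶ cokernel j := cokernel.map k j (𝟙 V) P.π (by simp [k, hm₁])
  have : WeakEquivalence J := weakEquivalence_cokernel_map j P.i₁ k hm₁
  have hJp : J ≫ p = 𝟙 _ := by
    rw [← cancel_epi (cokernel.π j)]
    simp [J, p]
  have : WeakEquivalence p := weakEquivalence_of_precomp_of_fac hJp
  have := weakEquivalence_coprod_inl_comp_cokernel_π m
  have hπ : (coprod.inl ≫ m ≫ cokernel.π k) ≫ p = cokernel.π j := by
    simp [p, reassoc_of% hm₀]
  rw [← hπ]
  infer_instance

end CollapsingContractible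

section CofiberSequences

lemma IsCofiberSequence.exists_fibrant {C : Type u} [Category.{v} C] [ModelCategory C]
    [HasZeroMorphisms C] {X Y Z : Ho C} {f : X ⟶ Y} {g : Y ⟶ Z} (h : IsCofiberSequence f g) :
    ∃ (A B : C) (i : A ⟶ B) (_ : IsCofibrant A) (_ : IsFibrant B) (_ : Cofibration i)
      (a : X ≅ (toHo C).obj A) (b : Y ≅ (toHo C).obj B) (c : Z ≅ (toHo C).obj (cokernel i)),
      f ≫ b.hom = a.hom ≫ (toHo C).map i ∧
        g ≫ c.hom = b.hom ≫ (toHo C).map (cokernel.π i) := by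
  obtain ⟨A, B, i, _, _, a, b, c, hf, hg⟩ := h
  let k := i ≫ fibRepHom B
  let J : cokernel i ⟶ cokernel k := cokernel.map i k (𝟙 A) (fibRepHom B) (by simp [k])
  have : WeakEquivalence J := weakEquivalence_cokernel_map i (fibRepHom B) k rfl
  have := isIso_toHo_map (fibRepHom B)
  have := isIso_toHo_map J
  refine ⟨A, fibRep B, k, inferInstance, inferInstance, inferInstance, a,
    b ≪≫ asIso ((toHo C).map (fibRepHom B)), c ≪≫ asIso ((toHo C).map J), ?_, ?_⟩
  · simp [k, reassoc_of% hf]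
  · simp only [Iso.trans_hom, asIso_hom, reassoc_of% hg, ← Functor.map_comp, Category.assoc,
      J, cokernel.π_desc, k]

variable {C : Type u} [Category.{v} C] [ModelCategory C] [HasZeroObject C] [HasZeroMorphisms C]

open ZeroObject

/-- On a cofibrant object the suspension functor is computed by the quotient of the cone. -/
def suspensionIso (A : C) [IsCofibrant A] :
    (suspension C).obj ((toHo C).obj A) ≅ (toHo C).obj (suspObj A) :=
  (Localization.fac (suspCof C) (suspCof_inverts C) (CofibrantObject.ι ⋙ toHo C)).app
    (CofibrantObject.mk A)

lemma suspensionIso_naturality {A B : C} [IsCofibrant A] [IsCofibrant B] (f : A ⟶ B) :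
    (suspension C).map ((toHo C).map f) ≫ (suspensionIso B).hom =
      (suspensionIso A).hom ≫ (toHo C).map (suspMap f) :=
  (Localization.fac (suspCof C) (suspCof_inverts C)
    (CofibrantObject.ι ⋙ toHo C)).hom.naturality (CofibrantObject.homMk f)

lemma weakEquivalence_zero_cone (A : C) : WeakEquivalence (0 : cone A ⟶ (0 : C)) :=
  (isContractibleFibrant_cone A).2

instance (A : C) [IsCofibrant A] : IsCofibrant (cone A) := isCofibrant_of_cofibration (coneι A)

/-- The mapping cone of `i : A ⟶ B`: the object `B` with the cone of `A` glued along `i`. -/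
abbrev mappingCone {A B : C} (i : A ⟶ B) : C := pushout i (coneι A)

/-- The morphism from the mapping cone to the cokernel that collapses the cone. -/
def mappingConeToCokernel {A B : C} (i : A ⟶ B) : mappingCone i ⟶ cokernel i :=
  pushout.desc (cokernel.π i) 0 (by simp)

lemma inl_mappingConeToCokernel {A B : C} (i : A ⟶ B) :
    pushout.inl _ _ ≫ mappingConeToCokernel i = cokernel.π i :=
  pushout.inl_desc _ _ _

lemma inr_mappingConeToCokernel {A B : C} (i : A ⟶ B) :
    pushout.inr _ _ ≫ mappingConeToCokernel i = 0 :=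
  pushout.inr_desc _ _ _

instance weakEquivalence_mappingConeToCokernel {A B : C} (i : A ⟶ B) [IsCofibrant A]
    [Cofibration i] : WeakEquivalence (mappingConeToCokernel i) := by
  let φ : cokernel i ⟶ cokernel (pushout.inr i (coneι A)) :=
    cokernel.map _ _ (coneι A) (pushout.inl _ _) pushout.condition
  have : IsIso φ := isIso_cokernel_map_of_isPushout (IsPushout.of_hasPushout i (coneι A))
  have := weakEquivalence_cokernel_π (pushout.inr i (coneι A)) (weakEquivalence_zero_cone A)
  refine weakEquivalence_of_postcomp_of_fac (g := φ) (fg := cokernel.π _) ?_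
  apply pushout.hom_ext
  · rw [reassoc_of% inl_mappingConeToCokernel, cokernel.π_desc]
  · rw [reassoc_of% inr_mappingConeToCokernel, zero_comp, cokernel.condition]

/-- The identification of the suspension of `A` with the quotient by `B` of the mapping cone of
`A ⟶ B`. -/
def suspObjToCokernelInl {A B : C} (i : A ⟶ B) :
    suspObj A ⟶ cokernel (pushout.inl i (coneι A)) :=
  cokernel.map _ _ i (pushout.inr _ _) pushout.condition.symm

instance {A B : C} (i : A ⟶ B) : IsIso (suspObjToCokernelInl i) :=
  isIso_cokernel_map_of_isPushout (IsPushout.of_hasPushout i (coneι A)).flip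

lemma IsCofiberSequence.rotate {X Y Z : Ho C} {f : X ⟶ Y} {g : Y ⟶ Z}
    (h : IsCofiberSequence f g) :
    ∃ δ : Z ⟶ (suspension C).obj X, IsCofiberSequence g δ := by
  obtain ⟨A, B, i, _, _, a, b, c, -, hg⟩ := h
  have : IsCofibrant B := isCofibrant_of_cofibration i
  have := isIso_toHo_map (mappingConeToCokernel i)
  let c' : Z ≅ (toHo C).obj (mappingCone i) :=
    c ≪≫ (asIso ((toHo C).map (mappingConeToCokernel i))).symm
  let d : (suspension C).obj X ≅ (toHo C).obj (cokernel (pushout.inl i (coneι A))) :=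
    (suspension C).mapIso a ≪≫ suspensionIso A ≪≫ (toHo C).mapIso (asIso (suspObjToCokernelInl i))
  refine ⟨c'.hom ≫ (toHo C).map (cokernel.π _) ≫ d.inv, B, mappingCone i, pushout.inl _ _,
    inferInstance, inferInstance, b, c', d, ?_, by simp⟩
  simp only [c', Iso.trans_hom, Iso.symm_hom, asIso_inv, reassoc_of% hg,
    ← inl_mappingConeToCokernel i, Functor.map_comp, Category.assoc, IsIso.hom_inv_id,
    Category.comp_id]

end CofiberSequences

section WeakKernels

variable {T : Type u} [Category.{v} T] [HasZeroMorphisms T]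

/-- A weak cokernel `g` of `f`: it satisfies the existence part of the universal property of the
cokernel. -/
structure IsWeakCokernel {X Y Z : T} (f : X ⟶ Y) (g : Y ⟶ Z) : Prop where
  zero : f ≫ g = 0
  exists_desc : ∀ {W : T} (u : Y ⟶ W), f ≫ u = 0 → ∃ v : Z ⟶ W, g ≫ v = u

/-- A weak kernel `f` of `g`: it satisfies the existence part of the universal property of the
kernel. -/
structure IsWeakKernel {X Y Z : T} (f : X ⟶ Y) (g : Y ⟶ Z) : Prop where
  zero : f ≫ g = 0
  exists_lift : ∀ {W : T} (u : W ⟶ Y), u ≫ g = 0 → ∃ v : W ⟶ X, v ≫ f = u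

end WeakKernels

section Exactness

variable {C : Type u} [Category.{v} C] [ModelCategory C] [HasZeroObject C] [HasZeroMorphisms C]

lemma toHo_map_suspMap_eq_comp {T B Z : C} {u : T ⟶ B} {k : B ⟶ Z} {H : cone T ⟶ Z}
    (hH : coneι T ≫ H = u ≫ k) {e : Z ⟶ cone B} (he : k ≫ e = coneι B) :
    (toHo C).map (suspMap u) = (toHo C).map (cokernel.map (coneι T) k u H hH) ≫
      (toHo C).map (cokernel.map k (coneι B) (𝟙 B) e (by simp [he])) := by
  rw [toHo_map_suspMap u (H ≫ e) (by rw [reassoc_of% hH, he]), ← Functor.map_comp]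
  congr 1
  rw [← cancel_epi (cokernel.π (coneι T))]
  simp

lemma isIso_toHo_map_cokernel_map_inr_comp {A B Z : C} (i : A ⟶ B) (w : mappingCone i ⟶ Z)
    [Cofibration w] [WeakEquivalence w] :
    IsIso ((toHo C).map (cokernel.map (coneι A) (pushout.inl i (coneι A) ≫ w) i
      (pushout.inr i (coneι A) ≫ w) (pushout.condition_assoc w).symm)) := by
  let ψ : cokernel (pushout.inl i (coneι A)) ⟶ cokernel (pushout.inl i (coneι A) ≫ w) :=
    cokernel.map _ _ (𝟙 B) w (by simp)
  have : WeakEquivalence ψ := weakEquivalence_cokernel_map _ w _ rfl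
  have hψ : cokernel.map (coneι A) (pushout.inl i (coneι A) ≫ w) i
      (pushout.inr i (coneι A) ≫ w) (pushout.condition_assoc w).symm =
      suspObjToCokernelInl i ≫ ψ := by
    rw [← cancel_epi (cokernel.π (coneι A))]
    simp [ψ, suspObjToCokernelInl]
  rw [hψ]
  exact isIso_toHo_map _

open ZeroObject

variable [HasZeroMorphisms (Ho C)]

lemma toHo_map_zero (A B : C) : (toHo C).map (0 : A ⟶ B) = 0 := by
  have e : (0 : A ⟶ B) = (0 : A ⟶ (0 : C)) ≫ 0 := by simp
  rw [e, Functor.map_comp,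
    (isZero_toHo_obj (isZero_zero C)).eq_zero_of_tgt ((toHo C).map (0 : A ⟶ (0 : C))), zero_comp]

lemma IsCofiberSequence.zero {X Y Z : Ho C} {f : X ⟶ Y} {g : Y ⟶ Z}
    (h : IsCofiberSequence f g) : f ≫ g = 0 := by
  obtain ⟨A, B, i, _, _, a, b, c, hf, hg⟩ := h
  rw [← cancel_mono c.hom, Category.assoc, hg, reassoc_of% hf, ← Functor.map_comp,
    cokernel.condition, toHo_map_zero, comp_zero, zero_comp]

lemma IsCofiberSequence.isWeakCokernel {X Y Z : Ho C} {f : X ⟶ Y} {g : Y ⟶ Z}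
    (h : IsCofiberSequence f g) : IsWeakCokernel f g where
  zero := h.zero
  exists_desc {W} u hu := by
    obtain ⟨A, B, i, _, _, a, b, c, hf, hg⟩ := h
    obtain ⟨T, _, _, ⟨e⟩⟩ := exists_iso_toHo_obj W
    have : IsCofibrant B := isCofibrant_of_cofibration i
    obtain ⟨t, ht⟩ := exists_toHo_map_eq (b.inv ≫ u ≫ e.hom)
    have hit : (toHo C).map (i ≫ t) = (toHo C).map 0 := by
      rw [toHo_map_zero, Functor.map_comp, ht, ← cancel_epi a.hom, ← reassoc_of% hf,
        Iso.hom_inv_id_assoc, reassoc_of% hu, zero_comp, comp_zero]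
    obtain ⟨t', ht', e'⟩ := exists_extension_of_toHo_map_eq i t 0 hit
    refine ⟨c.hom ≫ (toHo C).map (cokernel.desc i t' ht') ≫ e.inv, ?_⟩
    rw [reassoc_of% hg, ← Functor.map_comp_assoc, cokernel.π_desc, e', ht]
    simp

-- A null-homotopy of `T ⟶ B ⟶ B / A` induces a morphism between the suspensions of `T` and `A`,
-- which stability allows to desuspend.
lemma exists_lift_of_comp_cokernel_π_eq_zero [IsStable C] {A B T : C} (i : A ⟶ B)
    [IsCofibrant A] [Cofibration i] [IsCofibrant T] (u : T ⟶ B)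
    (hu : (toHo C).map (u ≫ cokernel.π i) = 0) :
    ∃ v : (toHo C).obj T ⟶ (toHo C).obj A, v ≫ (toHo C).map i = (toHo C).map u := by
  have : IsCofibrant B := isCofibrant_of_cofibration i
  have := isIso_toHo_map (mappingConeToCokernel i)
  let w := fibRepHom (mappingCone i)
  let k : B ⟶ fibRep (mappingCone i) := pushout.inl _ _ ≫ w
  have hinl : (toHo C).map (u ≫ pushout.inl i (coneι A)) = 0 := by
    rw [← cancel_mono ((toHo C).map (mappingConeToCokernel i)), ← Functor.map_comp,
      Category.assoc, inl_mappingConeToCokernel, hu, zero_comp]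
  have huk : (toHo C).map (coneι T ≫ 0) = (toHo C).map (u ≫ k) := by
    rw [comp_zero, toHo_map_zero, ← Category.assoc, Functor.map_comp, hinl, zero_comp]
  obtain ⟨H, hH, -⟩ := exists_extension_of_toHo_map_eq (coneι T) 0 (u ≫ k) huk
  obtain ⟨e, he⟩ := exists_extension k (coneι B) (isContractibleFibrant_cone B)
  have hsu := toHo_map_suspMap_eq_comp hH he
  have hsi := toHo_map_suspMap_eq_comp (u := i) (k := k) (H := pushout.inr i (coneι A) ≫ w)
    (pushout.condition_assoc w).symm he
  have := isIso_toHo_map_cokernel_map_inr_comp i w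
  let χ := asIso ((toHo C).map (cokernel.map (coneι A) k i (pushout.inr i (coneι A) ≫ w)
    (pushout.condition_assoc w).symm))
  have := IsStable.isEquivalence_suspension (C := C)
  obtain ⟨v, hv⟩ := (suspension C).map_surjective ((suspensionIso T).hom ≫
    (toHo C).map (cokernel.map (coneι T) k u H hH) ≫ χ.inv ≫ (suspensionIso A).inv)
  refine ⟨v, (suspension C).map_injective ?_⟩
  rw [← cancel_mono (suspensionIso B).hom, Functor.map_comp, hv, Category.assoc,
    suspensionIso_naturality, suspensionIso_naturality, hsu, hsi]
  simp [χ]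

lemma IsCofiberSequence.isWeakKernel [IsStable C] {X Y Z : Ho C} {f : X ⟶ Y} {g : Y ⟶ Z}
    (h : IsCofiberSequence f g) : IsWeakKernel f g where
  zero := h.zero
  exists_lift {W} u hu := by
    obtain ⟨A, B, i, _, _, _, a, b, c, hf, hg⟩ := h.exists_fibrant
    obtain ⟨T, _, _, ⟨e⟩⟩ := exists_iso_toHo_obj W
    obtain ⟨t, ht⟩ := exists_toHo_map_eq (e.inv ≫ u ≫ b.hom)
    have hti : (toHo C).map (t ≫ cokernel.π i) = 0 := by
      rw [Functor.map_comp, ht, Category.assoc, Category.assoc, ← hg, reassoc_of% hu,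
        zero_comp, comp_zero]
    obtain ⟨v, hv⟩ := exists_lift_of_comp_cokernel_π_eq_zero i t hti
    refine ⟨e.hom ≫ v ≫ a.inv, ?_⟩
    rw [← cancel_mono b.hom]
    simp only [Category.assoc, hf, Iso.inv_hom_id_assoc, hv, ht, Iso.hom_inv_id_assoc]

end Exactness

section GluingAlongContractible

lemma nonempty_isColimit_binaryCofan_of_existsUnique {C : Type u} [Category.{v} C] {X Y Z : C}
    {i : X ⟶ Z} {j : Y ⟶ Z}
    (h : ∀ {T : C} (f : X ⟶ T) (g : Y ⟶ T), ∃! m : Z ⟶ T, i ≫ m = f ∧ j ≫ m = g) :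
    Nonempty (IsColimit (BinaryCofan.mk i j)) :=
  ⟨BinaryCofan.IsColimit.mk _ (fun f g => (h f g).choose) (fun f g => (h f g).choose_spec.1.1)
    (fun f g => (h f g).choose_spec.1.2) (fun f g m hf hg => (h f g).choose_spec.2 m ⟨hf, hg⟩)⟩

lemma nonempty_isColimit_binaryCofan_cokernel_map {C : Type u} [Category.{v} C]
    [HasZeroMorphisms C] {V B B' E : C} {j : V ⟶ B} {j' : V ⟶ B'} {b : B ⟶ E} {b' : B' ⟶ E}
    (sq : IsPushout j j' b b') [HasCokernel j] [HasCokernel j'] [HasCokernel (j ≫ b)] :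
    Nonempty (IsColimit (BinaryCofan.mk (cokernel.map j (j ≫ b) (𝟙 V) b (by simp))
      (cokernel.map j' (j ≫ b) (𝟙 V) b' (by simp [sq.w])))) := by
  refine nonempty_isColimit_binaryCofan_of_existsUnique (fun f g =>
    ⟨cokernel.desc _ (sq.desc (cokernel.π j ≫ f) (cokernel.π j' ≫ g) (by simp)) (by simp),
      ⟨?_, ?_⟩, fun m ⟨hf, hg⟩ => ?_⟩)
  · simp [← cancel_epi (cokernel.π j)]
  · simp [← cancel_epi (cokernel.π j')]
  · rw [← cancel_epi (cokernel.π (j ≫ b)), cokernel.π_desc]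
    apply sq.hom_ext <;> simp [← hf, ← hg]

variable {C : Type u} [Category.{v} C] [ModelCategory C]

lemma existsUnique_toHo_desc {M M' P : C} [hM : IsCofibrant M] [hM' : IsCofibrant M'] {i : M ⟶ P}
    {j : M' ⟶ P} (h : IsColimit (BinaryCofan.mk i j)) {T : Ho C} (f : (toHo C).obj M ⟶ T)
    (g : (toHo C).obj M' ⟶ T) :
    ∃! m : (toHo C).obj P ⟶ T, (toHo C).map i ≫ m = f ∧ (toHo C).map j ≫ m = g := by
  obtain ⟨m, hm, hm'⟩ := existsUnique_toHo_cofan_desc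
    (fun j => by cases j; exacts [hM, hM']) h T (fun j => WalkingPair.casesOn j f g)
  exact ⟨m, ⟨hm .left, hm .right⟩, fun m' ⟨hf, hg⟩ =>
    hm' m' (by rintro (_ | _); exacts [hf, hg])⟩

variable [HasZeroObject C] [HasZeroMorphisms C]

open ZeroObject

lemma isCofibrant_cokernel {V W : C} (i : V ⟶ W) [Cofibration i] :
    IsCofibrant (cokernel i) := by
  have sq : IsPushout (0 : V ⟶ (0 : C)) i 0 (cokernel.π i) :=
    ⟨⟨by simp⟩, ⟨PushoutCocone.IsColimit.mk _
      (fun s => cokernel.desc _ s.inr (by rw [← s.condition, zero_comp]))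
      (fun s => (isZero_zero C).eq_of_src _ _) (fun s => by simp)
      (fun s m _ h => by simpa [← cancel_epi (cokernel.π i)] using h)⟩⟩
  have : Cofibration (0 : (0 : C) ⟶ cokernel i) := by
    rw [cofibration_iff]
    exact MorphismProperty.of_isPushout sq (mem_cofibrations i)
  have := isCofibrant_of_isZero (isZero_zero C)
  exact isCofibrant_of_cofibration (0 : (0 : C) ⟶ cokernel i)

lemma existsUnique_toHo_desc_of_isPushout {V B B' E : C} {j : V ⟶ B} {j' : V ⟶ B'} {b : B ⟶ E}
    {b' : B' ⟶ E} (sq : IsPushout j j' b b') [IsCofibrant V] [Cofibration j] [Cofibration j']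
    (hV : WeakEquivalence (0 : V ⟶ (0 : C))) {T : Ho C} (f : (toHo C).obj B ⟶ T)
    (g : (toHo C).obj B' ⟶ T) :
    ∃! m : (toHo C).obj E ⟶ T, (toHo C).map b ≫ m = f ∧ (toHo C).map b' ≫ m = g := by
  have : Cofibration b := by
    rw [cofibration_iff]
    exact MorphismProperty.of_isPushout sq (mem_cofibrations j')
  have isIso_π {W : C} (i : V ⟶ W) [Cofibration i] : IsIso ((toHo C).map (cokernel.π i)) := by
    have := weakEquivalence_cokernel_π i hV
    exact isIso_toHo_map _
  have := isCofibrant_cokernel j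
  have := isCofibrant_cokernel j'
  have hb : (toHo C).map (cokernel.π j) ≫ (toHo C).map (cokernel.map j (j ≫ b) (𝟙 V) b (by simp)) =
      (toHo C).map b ≫ (toHo C).map (cokernel.π (j ≫ b)) := by
    rw [← Functor.map_comp, ← Functor.map_comp, cokernel.π_desc]
  have hb' : (toHo C).map (cokernel.π j') ≫
      (toHo C).map (cokernel.map j' (j ≫ b) (𝟙 V) b' (by simp [sq.w])) =
      (toHo C).map b' ≫ (toHo C).map (cokernel.π (j ≫ b)) := by
    rw [← Functor.map_comp, ← Functor.map_comp, cokernel.π_desc]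
  obtain ⟨h⟩ := nonempty_isColimit_binaryCofan_cokernel_map sq
  obtain ⟨m, ⟨hf, hg⟩, hm⟩ := existsUnique_toHo_desc h (inv ((toHo C).map (cokernel.π j)) ≫ f)
    (inv ((toHo C).map (cokernel.π j')) ≫ g)
  refine ⟨(toHo C).map (cokernel.π (j ≫ b)) ≫ m, ⟨?_, ?_⟩, fun m' ⟨hf', hg'⟩ => ?_⟩
  · rw [← reassoc_of% hb, hf, IsIso.hom_inv_id_assoc]
  · rw [← reassoc_of% hb', hg, IsIso.hom_inv_id_assoc]
  · rw [← IsIso.inv_comp_eq]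
    refine hm _ ⟨?_, ?_⟩
    · rw [IsIso.eq_inv_comp, reassoc_of% hb, IsIso.hom_inv_id_assoc, hf']
    · rw [IsIso.eq_inv_comp, reassoc_of% hb', IsIso.hom_inv_id_assoc, hg']

end GluingAlongContractible

section ConeUnion

variable {C : Type u} [Category.{v} C] [ModelCategory C] [HasZeroObject C] [HasZeroMorphisms C]
  (S : C) {n : ℕ}

variable (n) in
/-- The union of `n` copies of the cone of `S` along their common base. It plays the role of the
contractible groupoid on `n` objects: homotopy classes of morphisms from it are configurations of
`n` null-homotopies of one morphism from `S`, of which two differ by a morphism from the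
suspension. -/
def coneUnion : C := widePushout S (fun _ : Fin n => cone S) (fun _ => coneι S)

namespace coneUnion

/-- The inclusion of a cone. -/
def ι (j : Fin n) : cone S ⟶ coneUnion S n :=
  WidePushout.ι (fun _ : Fin n => coneι S) j

lemma coneι_ι (i j : Fin n) : coneι S ≫ ι S i = coneι S ≫ ι S j :=
  (WidePushout.arrow_ι (fun _ : Fin n => coneι S) i).trans
    (WidePushout.arrow_ι (fun _ : Fin n => coneι S) j).symm

variable {S}

lemma hom_ext [NeZero n] {T : C} {f g : coneUnion S n ⟶ T} (h : ∀ j, ι S j ≫ f = ι S j ≫ g) :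
    f = g := by
  refine WidePushout.hom_ext _ _ _ h ?_
  rw [← WidePushout.arrow_ι (fun _ : Fin n => coneι S) 0]
  exact ((Category.assoc _ _ _).trans (congrArg _ (h 0))).trans (Category.assoc _ _ _).symm

/-- The morphism from the union given by morphisms from the cones that agree on the base. -/
def desc [NeZero n] {T : C} (f : Fin n → (cone S ⟶ T))
    (h : ∀ i j, coneι S ≫ f i = coneι S ≫ f j) : coneUnion S n ⟶ T :=
  WidePushout.desc (coneι S ≫ f 0) f (fun j => h j 0)

@[simp]
lemma ι_desc [NeZero n] {T : C} (f : Fin n → (cone S ⟶ T))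
    (h : ∀ i j, coneι S ≫ f i = coneι S ≫ f j) (j : Fin n) : ι S j ≫ desc f h = f j :=
  WidePushout.ι_desc _ _ _ _ j

@[simp]
lemma ι_desc_assoc [NeZero n] {T T' : C} (f : Fin n → (cone S ⟶ T))
    (h : ∀ i j, coneι S ≫ f i = coneι S ≫ f j) (j : Fin n) (t : T ⟶ T') :
    ι S j ≫ desc f h ≫ t = f j ≫ t := by
  rw [← Category.assoc, ι_desc]

variable (S) in
/-- The morphism that sends the cone of index `j` to the cone of index `φ j`. -/
def reindex {m : ℕ} [NeZero m] (φ : Fin m → Fin n) : coneUnion S m ⟶ coneUnion S n :=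
  desc (fun j => ι S (φ j)) (fun _ _ => coneι_ι _ _ _)

@[simp]
lemma ι_reindex {m : ℕ} [NeZero m] (φ : Fin m → Fin n) (j : Fin m) :
    ι S j ≫ reindex S φ = ι S (φ j) :=
  ι_desc _ _ _

@[simp]
lemma ι_reindex_assoc {m : ℕ} [NeZero m] (φ : Fin m → Fin n) (j : Fin m) {T : C}
    (t : coneUnion S n ⟶ T) : ι S j ≫ reindex S φ ≫ t = ι S (φ j) ≫ t := by
  rw [← Category.assoc, ι_reindex]

lemma reindex_comp_reindex {l m : ℕ} [NeZero l] [NeZero m] (φ : Fin l → Fin m)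
    (ψ : Fin m → Fin n) : reindex S φ ≫ reindex S ψ = reindex S (ψ ∘ φ) :=
  hom_ext (fun j => by simp)

variable (n) in
/-- The functoriality of the union of cones in the base. -/
def map [NeZero n] {S' : C} (f : S ⟶ S') : coneUnion S n ⟶ coneUnion S' n :=
  desc (fun j => coneMap f ≫ ι S' j) (fun i j => by
    rw [reassoc_of% coneι_coneMap, reassoc_of% coneι_coneMap, coneι_ι S' i j])

@[simp]
lemma ι_map [NeZero n] {S' : C} (f : S ⟶ S') (j : Fin n) :
    ι S j ≫ map n f = coneMap f ≫ ι S' j :=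
  ι_desc _ _ _

@[simp]
lemma ι_map_assoc [NeZero n] {S' : C} (f : S ⟶ S') (j : Fin n) {T : C}
    (t : coneUnion S' n ⟶ T) : ι S j ≫ map n f ≫ t = coneMap f ≫ ι S' j ≫ t := by
  rw [← Category.assoc, ι_map, Category.assoc]

lemma reindex_comp_map {m : ℕ} [NeZero m] [NeZero n] {S' : C} (φ : Fin m → Fin n) (f : S ⟶ S') :
    reindex S φ ≫ map n f = map m f ≫ reindex S' φ :=
  hom_ext (fun j => by simp)

variable (S) in
lemma isPushout_two : IsPushout (coneι S) (coneι S) (ι S (0 : Fin 2)) (ι S 1) := by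
  refine ⟨⟨coneι_ι _ _ _⟩, ⟨PushoutCocone.IsColimit.mk _ (fun s => desc ![s.inl, s.inr] ?_)
    (fun s => by simp) (fun s => by simp) (fun s m h₁ h₂ => hom_ext (fun j => ?_))⟩⟩
  · intro i j
    fin_cases i <;> fin_cases j <;> simp [s.condition]
  · fin_cases j <;> simp [h₁, h₂]

variable (S n) in
lemma isPushout_succ :
    IsPushout (ι S (Fin.last n)) (ι S 0) (reindex S Fin.castSucc)
      (reindex S ![(Fin.last n).castSucc, Fin.last (n + 1)]) := by
  refine ⟨⟨by simp⟩, ⟨PushoutCocone.IsColimit.mk _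
    (fun s => desc (Fin.lastCases (ι S 1 ≫ s.inr) (fun j => ι S j ≫ s.inl)) ?_)
    (fun s => hom_ext (fun j => by simp)) (fun s => hom_ext (fun j => ?_))
    (fun s m h₁ h₂ => hom_ext (fun j => ?_))⟩⟩
  · have h (i : Fin (n + 2)) : coneι S ≫ (Fin.lastCases (ι S 1 ≫ s.inr)
        (fun j => ι S j ≫ s.inl) i : cone S ⟶ s.pt) = coneι S ≫ ι S (Fin.last n) ≫ s.inl := by
      refine Fin.lastCases ?_ (fun j => ?_) i
      · rw [Fin.lastCases_last, s.condition, ← Category.assoc, ← Category.assoc, coneι_ι S 1 0]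
      · rw [Fin.lastCases_castSucc, ← Category.assoc, ← Category.assoc, coneι_ι S j (Fin.last n)]
    exact fun i j => (h i).trans (h j).symm
  · fin_cases j
    · simpa using s.condition
    · simp
  · refine Fin.lastCases ?_ (fun j => ?_) j
    · simp [← h₂]
    · simp [← h₁]

variable (S n) in
lemma cofibration_ι_last : Cofibration (ι S (Fin.last n)) := by
  induction n with
  | zero =>
    have : IsIso (ι S (Fin.last 0)) :=
      ⟨desc (fun _ => 𝟙 _) (fun _ _ => rfl), by simp, hom_ext (fun j => by
        obtain rfl : j = Fin.last 0 := Subsingleton.elim (α := Fin 1) _ _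
        simp)⟩
    infer_instance
  | succ n hn =>
    have : Cofibration (ι S (1 : Fin 2)) := by
      rw [cofibration_iff]
      exact MorphismProperty.of_isPushout (isPushout_two S).flip (mem_cofibrations _)
    have : Cofibration (reindex S ![(Fin.last n).castSucc, Fin.last (n + 1)]) := by
      rw [cofibration_iff]
      exact MorphismProperty.of_isPushout (isPushout_succ S n).flip
        (mem_cofibrations (ι S (Fin.last n)))
    have hι : ι S 1 ≫ reindex S ![(Fin.last n).castSucc, Fin.last (n + 1)] =
        ι S (Fin.last (n + 1)) := ι_reindex _ _
    rw [← hι]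
    infer_instance

variable (S) in
/-- The morphism from the union of two cones to the suspension that collapses the second cone. -/
def toSuspObj : coneUnion S 2 ⟶ suspObj S :=
  desc ![cokernel.π _, 0] (fun i j => by fin_cases i <;> fin_cases j <;> simp)

instance [IsCofibrant S] : WeakEquivalence (toSuspObj S) := by
  have e : toSuspObj S = (isPushout_two S).isoPushout.hom ≫ mappingConeToCokernel (coneι S) := by
    refine hom_ext (fun j => ?_)
    fin_cases j
    · simp [toSuspObj, inl_mappingConeToCokernel]
    · simp [toSuspObj, inr_mappingConeToCokernel]
  rw [e]
  infer_instance

lemma map_comp_toSuspObj {S' : C} (f : S ⟶ S') :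
    map 2 f ≫ toSuspObj S' = toSuspObj S ≫ suspMap f :=
  hom_ext (fun j => by fin_cases j <;> simp [toSuspObj, suspMap])

variable (S) in
/-- On a cofibrant object the suspension functor is computed by the union of two cones. -/
def suspensionIso [IsCofibrant S] :
    (suspension C).obj ((toHo C).obj S) ≅ (toHo C).obj (coneUnion S 2) :=
  have := isIso_toHo_map (toSuspObj S)
  StableModel.suspensionIso S ≪≫ (asIso ((toHo C).map (toSuspObj S))).symm

lemma suspensionIso_naturality [IsCofibrant S] {S' : C} [IsCofibrant S'] (f : S ⟶ S') :
    (suspension C).map ((toHo C).map f) ≫ (suspensionIso S').hom =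
      (suspensionIso S).hom ≫ (toHo C).map (map 2 f) := by
  have := isIso_toHo_map (toSuspObj S)
  have := isIso_toHo_map (toSuspObj S')
  rw [← cancel_mono ((toHo C).map (toSuspObj S'))]
  simp [suspensionIso, ← Functor.map_comp, map_comp_toSuspObj,
    StableModel.suspensionIso_naturality]

lemma exists_toHo_map_map_eq [IsStable C] [IsCofibrant S] {S' : C} [IsCofibrant S']
    [IsFibrant S'] (g : (toHo C).obj (coneUnion S 2) ⟶ (toHo C).obj (coneUnion S' 2)) :
    ∃ f : S ⟶ S', (toHo C).map (map 2 f) = g := by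
  have := IsStable.isEquivalence_suspension (C := C)
  obtain ⟨k, hk⟩ := (suspension C).map_surjective
    ((suspensionIso S).hom ≫ g ≫ (suspensionIso S').inv)
  obtain ⟨f, rfl⟩ := exists_toHo_map_eq k
  refine ⟨f, ?_⟩
  rw [← cancel_epi (suspensionIso S).hom, ← suspensionIso_naturality, hk]
  simp

end coneUnion

lemma exists_iso_coneUnion [IsStable C] (X : Ho C) :
    ∃ (S : C) (_ : IsCofibrant S) (_ : IsFibrant S),
      Nonempty (X ≅ (toHo C).obj (coneUnion S 2)) := by
  have := IsStable.isEquivalence_suspension (C := C)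
  obtain ⟨S, _, _, ⟨e⟩⟩ := exists_iso_toHo_obj ((suspension C).objPreimage X)
  exact ⟨S, inferInstance, inferInstance, ⟨((suspension C).objObjPreimageIso X).symm ≪≫
    (suspension C).mapIso e ≪≫ coneUnion.suspensionIso S⟩⟩

end ConeUnion

section EdgeGroup

variable {C : Type u} [Category.{v} C] [ModelCategory C] [HasZeroObject C] [HasZeroMorphisms C]
  {S : C} {T : Ho C} {l m n : ℕ} [NeZero l] [NeZero m]

open ZeroObject

/-- The restriction of a morphism from a union of cones along a reindexing. -/
def coneRestrict (φ : Fin m → Fin n) (z : (toHo C).obj (coneUnion S n) ⟶ T) :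
    (toHo C).obj (coneUnion S m) ⟶ T :=
  (toHo C).map (coneUnion.reindex S φ) ≫ z

lemma coneRestrict_coneRestrict (φ : Fin l → Fin m) (ψ : Fin m → Fin n)
    (z : (toHo C).obj (coneUnion S n) ⟶ T) :
    coneRestrict φ (coneRestrict ψ z) = coneRestrict (ψ ∘ φ) z := by
  simp only [coneRestrict]
  rw [← Functor.map_comp_assoc, coneUnion.reindex_comp_reindex]

lemma coneRestrict_comp (φ : Fin m → Fin n) (z : (toHo C).obj (coneUnion S n) ⟶ T) {T' : Ho C}
    (g : T ⟶ T') : coneRestrict φ z ≫ g = coneRestrict φ (z ≫ g) :=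
  Category.assoc _ _ _

lemma comp_coneRestrict [NeZero n] {S' : C} (f : S ⟶ S') (φ : Fin m → Fin n)
    (z : (toHo C).obj (coneUnion S' n) ⟶ T) :
    (toHo C).map (coneUnion.map m f) ≫ coneRestrict φ z =
      coneRestrict φ ((toHo C).map (coneUnion.map n f) ≫ z) := by
  simp only [coneRestrict]
  rw [← Functor.map_comp_assoc, ← Functor.map_comp_assoc, coneUnion.reindex_comp_map]

lemma coneRestrict_zero_one (z : (toHo C).obj (coneUnion S 2) ⟶ T) :
    coneRestrict ![0, 1] z = z := by
  have : coneUnion.reindex S (![0, 1] : Fin 2 → Fin 2) = 𝟙 _ :=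
    coneUnion.hom_ext (fun j => by fin_cases j <;> simp)
  rw [coneRestrict, this, CategoryTheory.Functor.map_id, Category.id_comp]

lemma coneRestrict_const [HasZeroMorphisms (Ho C)] (i : Fin n)
    (z : (toHo C).obj (coneUnion S n) ⟶ T) : coneRestrict ![i, i] z = 0 := by
  let p : coneUnion S 2 ⟶ cone S := coneUnion.desc (fun _ => 𝟙 _) (fun _ _ => rfl)
  have hp : coneUnion.reindex S ![i, i] = p ≫ coneUnion.ι S i :=
    coneUnion.hom_ext (fun j => by fin_cases j <;> simp [p])
  have := weakEquivalence_zero_cone S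
  have := isIso_toHo_map (0 : cone S ⟶ (0 : C))
  have hS : IsZero ((toHo C).obj (cone S)) :=
    (isZero_toHo_obj (isZero_zero C)).of_iso (asIso ((toHo C).map (0 : cone S ⟶ (0 : C))))
  rw [coneRestrict, hp, Functor.map_comp, hS.eq_zero_of_tgt ((toHo C).map p), zero_comp,
    zero_comp]

variable [IsCofibrant S]

lemma existsUnique_coneRestrict (x : (toHo C).obj (coneUnion S (n + 1)) ⟶ T)
    (y : (toHo C).obj (coneUnion S 2) ⟶ T) :
    ∃! z : (toHo C).obj (coneUnion S (n + 2)) ⟶ T, coneRestrict Fin.castSucc z = x ∧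
      coneRestrict ![(Fin.last n).castSucc, Fin.last (n + 1)] z = y := by
  have := coneUnion.cofibration_ι_last S n
  have : Cofibration (coneUnion.ι S (0 : Fin 2)) := by
    rw [cofibration_iff]
    exact MorphismProperty.of_isPushout (coneUnion.isPushout_two S) (mem_cofibrations _)
  exact existsUnique_toHo_desc_of_isPushout (coneUnion.isPushout_succ S n)
    (weakEquivalence_zero_cone S) x y

lemma existsUnique_coneRestrict_pair (x y : (toHo C).obj (coneUnion S 2) ⟶ T) :
    ∃! z : (toHo C).obj (coneUnion S 3) ⟶ T,
      coneRestrict ![0, 1] z = x ∧ coneRestrict ![1, 2] z = y := by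
  have h₀₁ : (Fin.castSucc : Fin 2 → Fin 3) = ![0, 1] := by decide
  have h₁₂ : (![(Fin.last 1).castSucc, Fin.last 2] : Fin 2 → Fin 3) = ![1, 2] := by decide
  rw [← h₀₁, ← h₁₂]
  exact existsUnique_coneRestrict x y

lemma exists_coneRestrict_triple (x y w : (toHo C).obj (coneUnion S 2) ⟶ T) :
    ∃ z : (toHo C).obj (coneUnion S 4) ⟶ T,
      coneRestrict ![0, 1] z = x ∧ coneRestrict ![1, 2] z = y ∧ coneRestrict ![2, 3] z = w := by
  have h₀₁ : (Fin.castSucc ∘ ![0, 1] : Fin 2 → Fin 4) = ![0, 1] := by decide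
  have h₁₂ : (Fin.castSucc ∘ ![1, 2] : Fin 2 → Fin 4) = ![1, 2] := by decide
  have h₂₃ : (![(Fin.last 2).castSucc, Fin.last 3] : Fin 2 → Fin 4) = ![2, 3] := by decide
  obtain ⟨z, ⟨rfl, rfl⟩, -⟩ := existsUnique_coneRestrict_pair x y
  obtain ⟨z, ⟨rfl, rfl⟩, -⟩ := existsUnique_coneRestrict z w
  refine ⟨z, ?_, ?_, ?_⟩
  · rw [coneRestrict_coneRestrict, h₀₁]
  · rw [coneRestrict_coneRestrict, h₁₂]
  · rw [h₂₃]

/-- The composition of two consecutive edges, where an edge is a morphism from the union of two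
cones. -/
def edgeAdd (x y : (toHo C).obj (coneUnion S 2) ⟶ T) : (toHo C).obj (coneUnion S 2) ⟶ T :=
  coneRestrict ![0, 2] (existsUnique_coneRestrict_pair x y).choose

lemma edgeAdd_coneRestrict (z : (toHo C).obj (coneUnion S n) ⟶ T) (i j k : Fin n) :
    edgeAdd (coneRestrict ![i, j] z) (coneRestrict ![j, k] z) = coneRestrict ![i, k] z := by
  have h₀₁ : ![i, j, k] ∘ ![0, 1] = ![i, j] := by ext a; fin_cases a <;> rfl
  have h₁₂ : ![i, j, k] ∘ ![1, 2] = ![j, k] := by ext a; fin_cases a <;> rfl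
  have h₀₂ : ![i, j, k] ∘ ![0, 2] = ![i, k] := by ext a; fin_cases a <;> rfl
  have h := existsUnique_coneRestrict_pair (coneRestrict ![i, j] z) (coneRestrict ![j, k] z)
  have hz : h.choose = coneRestrict ![i, j, k] z := h.unique h.choose_spec.1
    ⟨by rw [coneRestrict_coneRestrict, h₀₁], by rw [coneRestrict_coneRestrict, h₁₂]⟩
  rw [edgeAdd, hz, coneRestrict_coneRestrict, h₀₂]

/-- The group of edges: they compose as in a groupoid, and the loops are trivial. -/
abbrev edgeAddGroup [HasZeroMorphisms (Ho C)] : AddGroup ((toHo C).obj (coneUnion S 2) ⟶ T) :=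
  letI : Add ((toHo C).obj (coneUnion S 2) ⟶ T) := ⟨edgeAdd⟩
  letI : Neg ((toHo C).obj (coneUnion S 2) ⟶ T) := ⟨coneRestrict ![1, 0]⟩
  AddGroup.ofLeftAxioms
    (fun x y w => by
      change edgeAdd (edgeAdd _ _) _ = edgeAdd _ (edgeAdd _ _)
      obtain ⟨z, rfl, rfl, rfl⟩ := exists_coneRestrict_triple x y w
      simp only [edgeAdd_coneRestrict])
    (fun x => by
      change edgeAdd 0 x = x
      nth_rw 1 [← coneRestrict_const 0 x]
      nth_rw 2 [← coneRestrict_zero_one x]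
      rw [edgeAdd_coneRestrict, coneRestrict_zero_one])
    (fun x => by
      change edgeAdd (coneRestrict ![1, 0] x) x = 0
      nth_rw 2 [← coneRestrict_zero_one x]
      rw [edgeAdd_coneRestrict, coneRestrict_const])

lemma edgeAdd_comp {T' : Ho C} (x y : (toHo C).obj (coneUnion S 2) ⟶ T) (g : T ⟶ T') :
    edgeAdd x y ≫ g = edgeAdd (x ≫ g) (y ≫ g) := by
  obtain ⟨z, ⟨rfl, rfl⟩, -⟩ := existsUnique_coneRestrict_pair x y
  simp only [coneRestrict_comp, edgeAdd_coneRestrict]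

lemma comp_edgeAdd {S' : C} [IsCofibrant S'] (f : S ⟶ S')
    (x y : (toHo C).obj (coneUnion S' 2) ⟶ T) :
    (toHo C).map (coneUnion.map 2 f) ≫ edgeAdd x y =
      edgeAdd ((toHo C).map (coneUnion.map 2 f) ≫ x) ((toHo C).map (coneUnion.map 2 f) ≫ y) := by
  obtain ⟨z, ⟨rfl, rfl⟩, -⟩ := existsUnique_coneRestrict_pair x y
  simp only [comp_coneRestrict, edgeAdd_coneRestrict]

end EdgeGroup

section Preadditive

/-- A category enriched in groups with bilinear composition is preadditive: expanding
`(𝟙 + 𝟙) ≫ (b + a)` in two ways shows that the groups are commutative. -/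
abbrev preadditiveOfAddGroup {T : Type u} [Category.{v} T] (G : ∀ X Y : T, AddGroup (X ⟶ Y))
    (add_comp : ∀ (X Y Z : T) (f f' : X ⟶ Y) (g : Y ⟶ Z), (f + f') ≫ g = f ≫ g + f' ≫ g)
    (comp_add : ∀ (X Y Z : T) (f : X ⟶ Y) (g g' : Y ⟶ Z), f ≫ (g + g') = f ≫ g + f ≫ g') :
    Preadditive T where
  homGroup X Y :=
    { G X Y with
      add_comm := fun a b => by
        have h : (b + b) + (a + a) = (b + a) + (b + a) := by
          have h' := (comp_add X X Y (𝟙 X + 𝟙 X) b a).symm.trans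
            (add_comp X X Y (𝟙 X) (𝟙 X) (b + a))
          simpa only [add_comp, Category.id_comp] using h'
        rw [add_assoc, add_assoc, add_left_cancel_iff, ← add_assoc, ← add_assoc,
          add_right_cancel_iff] at h
        exact h.symm }
  add_comp := add_comp
  comp_add := comp_add

variable (C : Type u) [Category.{v} C] [ModelCategory C] [HasZeroObject C] [HasZeroMorphisms C]
  [IsStable C]

lemma nonempty_preadditive : Nonempty (Preadditive (Ho C)) := by
  let _ : HasZeroMorphisms (Ho C) := HasZeroObject.zeroMorphismsOfZeroObject
  choose S _ _ e using exists_iso_coneUnion (C := C)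
  let e' (X : Ho C) := (e X).some
  let G (X Y : Ho C) : AddGroup (X ⟶ Y) :=
    letI := edgeAddGroup (S := S X) (T := Y)
    (Iso.homCongr (e' X) (Iso.refl Y)).addGroup
  have add_def {X Y : Ho C} (f g : X ⟶ Y) :
      letI := G X Y
      f + g = (e' X).hom ≫ edgeAdd ((e' X).inv ≫ f) ((e' X).inv ≫ g) := by
    change (e' X).hom ≫ edgeAdd ((e' X).inv ≫ f ≫ 𝟙 _) ((e' X).inv ≫ g ≫ 𝟙 _) ≫ 𝟙 _ = _
    simp only [Category.comp_id]
  refine ⟨preadditiveOfAddGroup G (fun X Y Z f f' g => ?_) (fun X Y Z f g g' => ?_)⟩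
  · simp only [add_def, Category.assoc, edgeAdd_comp]
  · obtain ⟨k, hk⟩ := coneUnion.exists_toHo_map_map_eq ((e' X).inv ≫ f ≫ (e' Y).hom)
    have hf : f = (e' X).hom ≫ (toHo C).map (coneUnion.map 2 k) ≫ (e' Y).inv := by simp [hk]
    rw [add_def, add_def, hf]
    simp only [Category.assoc, Iso.inv_hom_id_assoc, comp_edgeAdd]

end Preadditive

section FiveLemma

variable {T : Type u} [Category.{v} T] [Preadditive T]

lemma IsWeakCokernel.exact {X Y Z : T} {f : X ⟶ Y} {g : Y ⟶ Z} (h : IsWeakCokernel f g) (A : T) :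
    Function.Exact (Preadditive.leftComp A g) (Preadditive.leftComp A f) := fun u =>
  ⟨h.exists_desc u, by
    rintro ⟨v, rfl⟩
    exact (Category.assoc _ _ _).symm.trans ((congrArg (· ≫ v) h.zero).trans zero_comp)⟩

lemma IsWeakKernel.exact {X Y Z : T} {f : X ⟶ Y} {g : Y ⟶ Z} (h : IsWeakKernel f g) (A : T) :
    Function.Exact (Preadditive.rightComp A f) (Preadditive.rightComp A g) := fun u =>
  ⟨h.exists_lift u, by
    rintro ⟨v, rfl⟩
    exact (Category.assoc _ _ _).trans ((congrArg _ h.zero).trans comp_zero)⟩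

lemma bijective_comp_of_isWeakCokernel {X₁ X₂ X₃ X₄ X₅ : T} {f₁ : X₁ ⟶ X₂} {f₂ : X₂ ⟶ X₃}
    {f₃ : X₃ ⟶ X₄} {f₄ : X₄ ⟶ X₅} (h₁ : IsWeakCokernel f₁ f₂) (h₂ : IsWeakCokernel f₂ f₃)
    (h₃ : IsWeakCokernel f₃ f₄) {A B : T} (φ : A ⟶ B)
    (hX₁ : Function.Bijective (fun u : X₁ ⟶ A => u ≫ φ))
    (hX₂ : Function.Bijective (fun u : X₂ ⟶ A => u ≫ φ))
    (hX₄ : Function.Bijective (fun u : X₄ ⟶ A => u ≫ φ))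
    (hX₅ : Function.Bijective (fun u : X₅ ⟶ A => u ≫ φ)) :
    Function.Bijective (fun u : X₃ ⟶ A => u ≫ φ) := by
  have comm {X Y : T} (f : X ⟶ Y) : (Preadditive.leftComp B f).comp (Preadditive.rightComp Y φ) =
      (Preadditive.rightComp X φ).comp (Preadditive.leftComp A f) :=
    AddMonoidHom.ext (fun u => (Category.assoc f u φ).symm)
  exact AddMonoidHom.bijective_of_surjective_of_bijective_of_bijective_of_injective
    _ _ _ _ _ _ _ _ (Preadditive.rightComp X₅ φ) (Preadditive.rightComp X₄ φ)
    (Preadditive.rightComp X₃ φ) (Preadditive.rightComp X₂ φ) (Preadditive.rightComp X₁ φ)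
    (comm f₄) (comm f₃) (comm f₂) (comm f₁) (h₃.exact A) (h₂.exact A) (h₁.exact A) (h₃.exact B)
    (h₂.exact B) (h₁.exact B) hX₅.2 hX₄ hX₂ hX₁.1

lemma isIso_of_isWeakKernel {X₁ X₂ X₃ X₄ X₅ Y₁ Y₂ Y₃ Y₄ Y₅ : T} {f₁ : X₁ ⟶ X₂} {f₂ : X₂ ⟶ X₃}
    {f₃ : X₃ ⟶ X₄} {f₄ : X₄ ⟶ X₅} {g₁ : Y₁ ⟶ Y₂} {g₂ : Y₂ ⟶ Y₃} {g₃ : Y₃ ⟶ Y₄} {g₄ : Y₄ ⟶ Y₅}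
    (hf₁ : IsWeakKernel f₁ f₂) (hf₂ : IsWeakKernel f₂ f₃) (hf₃ : IsWeakKernel f₃ f₄)
    (hg₁ : IsWeakKernel g₁ g₂) (hg₂ : IsWeakKernel g₂ g₃) (hg₃ : IsWeakKernel g₃ g₄)
    {η₁ : X₁ ⟶ Y₁} {η₂ : X₂ ⟶ Y₂} {η₃ : X₃ ⟶ Y₃} {η₄ : X₄ ⟶ Y₄} {η₅ : X₅ ⟶ Y₅}
    (e₁ : f₁ ≫ η₂ = η₁ ≫ g₁) (e₂ : f₂ ≫ η₃ = η₂ ≫ g₂) (e₃ : f₃ ≫ η₄ = η₃ ≫ g₃)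
    (e₄ : f₄ ≫ η₅ = η₄ ≫ g₄) [IsIso η₁] [IsIso η₂] [IsIso η₄] [IsIso η₅] : IsIso η₃ := by
  refine isIso_of_yoneda_map_bijective η₃ (fun A => ?_)
  have comm {X X' Y Y' : T} {f : X ⟶ X'} {g : Y ⟶ Y'} {η : X ⟶ Y} {η' : X' ⟶ Y'}
      (e : f ≫ η' = η ≫ g) : (Preadditive.rightComp A g).comp (Preadditive.rightComp A η) =
        (Preadditive.rightComp A η').comp (Preadditive.rightComp A f) :=
    AddMonoidHom.ext (fun u => by simp [Preadditive.rightComp, e])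
  have bij {X Y : T} (η : X ⟶ Y) [IsIso η] : Function.Bijective (Preadditive.rightComp A η) :=
    (isIso_iff_yoneda_map_bijective η).1 inferInstance A
  exact AddMonoidHom.bijective_of_surjective_of_bijective_of_bijective_of_injective
    _ _ _ _ _ _ _ _ _ _ (Preadditive.rightComp A η₃) _ _ (comm e₁) (comm e₂) (comm e₃) (comm e₄)
    (hf₁.exact A) (hf₂.exact A) (hf₃.exact A) (hg₁.exact A) (hg₂.exact A) (hg₃.exact A)
    (bij η₁).2 (bij η₂) (bij η₄) (bij η₅).1

end FiveLemma

section Localising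

lemma bijective_iff_of_equiv {α α' β β' : Type*} (e : α ≃ α') (e' : β ≃ β') {f : α → β}
    {g : α' → β'} (h : ∀ a, e' (f a) = g (e a)) : Function.Bijective f ↔ Function.Bijective g := by
  rw [← e'.comp_bijective, ← Function.Bijective.of_comp_iff g e.bijective]
  exact iff_of_eq (congrArg _ (funext h))

lemma bijective_comp_iff_of_iso {T : Type u} [Category.{v} T] {X X' A B : T} (e : X ≅ X')
    (φ : A ⟶ B) : Function.Bijective (fun u : X ⟶ A => u ≫ φ) ↔
      Function.Bijective (fun u : X' ⟶ A => u ≫ φ) :=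
  bijective_iff_of_equiv (e.homCongr (Iso.refl A)) (e.homCongr (Iso.refl B)) (by simp)

lemma bijective_comp_map_iff {T : Type u} [Category.{v} T] {T' : Type u'} [Category.{v'} T']
    {G : T ⥤ T'} {H : T' ⥤ T} (adj : G ⊣ H) (X : T) {A B : T'} (φ : A ⟶ B) :
    Function.Bijective (fun u : G.obj X ⟶ A => u ≫ φ) ↔
      Function.Bijective (fun u : X ⟶ H.obj A => u ≫ H.map φ) :=
  bijective_iff_of_equiv (adj.homEquiv X A) (adj.homEquiv X B)
    (fun u => adj.homEquiv_naturality_right u φ)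

variable {C : Type u} [Category.{v} C] [ModelCategory C] [HasZeroObject C] [HasZeroMorphisms C]

lemma IsLocalising.of_cofiber {P : ObjectProperty (Ho C)} (zero : ∀ X, IsZero X → P X)
    (suspension_iff : ∀ X, P ((suspension C).obj X) ↔ P X)
    (cofiber : ∀ {X Y Z : Ho C} (f : X ⟶ Y) (g : Y ⟶ Z), IsCofiberSequence f g →
      P X → P Y → P Z)
    (coproduct : ∀ (I : Type w), P.IsClosedUnderColimitsOfShape (Discrete I)) :
    IsLocalising.{w} P where
  zero := zero
  suspension_iff := suspension_iff
  two_of_three₁ f g h hY hZ := by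
    obtain ⟨δ, hδ⟩ := h.rotate
    exact (suspension_iff _).1 (cofiber _ _ hδ hY hZ)
  two_of_three₂ f g h hX hZ := by
    obtain ⟨δ, hδ⟩ := h.rotate
    obtain ⟨ε, hε⟩ := hδ.rotate
    exact (suspension_iff _).1 (cofiber _ _ hε hZ ((suspension_iff _).2 hX))
  two_of_three₃ := cofiber
  coproduct := coproduct

variable [IsStable C]

variable (C) in
/-- The suspension of a stable model category as an autoequivalence of the homotopy category. -/
def suspensionEquiv : Ho C ≌ Ho C :=
  have := IsStable.isEquivalence_suspension (C := C)
  (suspension C).asEquivalence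

lemma isLocalising_isColocal (Φ : MorphismProperty (Ho C))
    (hΦ : Φ ≤ Φ.inverseImage (suspensionEquiv C).functor)
    (hΦ' : Φ ≤ Φ.inverseImage (suspensionEquiv C).inverse) : IsLocalising.{w} Φ.isColocal := by
  obtain ⟨_⟩ := nonempty_preadditive C
  have hs (X : Ho C) : Φ.isColocal ((suspension C).obj X) ↔ Φ.isColocal X := by
    refine ⟨fun h A B φ hφ => ?_, fun h A B φ hφ => ?_⟩
    · exact (bijective_iff_of_equiv (suspensionEquiv C).fullyFaithfulFunctor.homEquiv
        (suspensionEquiv C).fullyFaithfulFunctor.homEquiv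
        (fun u => (suspensionEquiv C).functor.map_comp u φ)).2 (h _ (hΦ _ hφ))
    · exact (bijective_comp_map_iff (suspensionEquiv C).toAdjunction X φ).2 (h _ (hΦ' _ hφ))
  refine .of_cofiber (fun X hX A B φ _ => ?_) hs (fun f g h hX hY A B φ hφ => ?_)
    (fun I => inferInstance)
  · exact ⟨fun _ _ _ => hX.eq_of_src _ _, fun t => ⟨hX.to_ _, hX.eq_of_src _ _⟩⟩
  · obtain ⟨δ, h₁⟩ := h.rotate
    obtain ⟨ε, h₂⟩ := h₁.rotate
    exact bijective_comp_of_isWeakCokernel h.isWeakCokernel h₁.isWeakCokernel h₂.isWeakCokernel φ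
      (hX φ hφ) (hY φ hφ) ((hs _).2 hX φ hφ) ((hs _).2 hY φ hφ)

lemma IsGeneratingSet.isIso_of_bijective_comp {K : Set C} (hK : IsGeneratingSet.{w} K)
    (S : ObjectProperty (Ho C)) (hS : ∀ X, S X → S ((suspensionEquiv C).functor.obj X))
    (hS' : ∀ X, S X → S ((suspensionEquiv C).inverse.obj X)) (hKS : ∀ k ∈ K, S ((toHo C).obj k))
    {A B : Ho C} (φ : A ⟶ B)
    (hφ : ∀ X, S X → Function.Bijective (fun u : X ⟶ A => u ≫ φ)) : IsIso φ := by
  let Φ : MorphismProperty (Ho C) := fun A B φ => ∀ X, S X →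
    Function.Bijective (fun u : X ⟶ A => u ≫ φ)
  refine isIso_of_yoneda_map_bijective φ (fun X => hK _
    (isLocalising_isColocal Φ ?_ ?_) (fun k hk _ _ ψ hψ => hψ _ (hKS k hk)) X φ hφ)
  · intro A B ψ hψ X hX
    exact (bijective_comp_map_iff (suspensionEquiv C).symm.toAdjunction X ψ).1 (hψ _ (hS' X hX))
  · intro A B ψ hψ X hX
    exact (bijective_comp_map_iff (suspensionEquiv C).toAdjunction X ψ).1 (hψ _ (hS X hX))

end Localising

section DerivedAdjunction

variable {C : Type u} [Category.{v} C] [ModelCategory C]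

instance isIso_toHo_map_cofRepHom (X : C) : IsIso ((toHo C).map (cofRepHom X)) :=
  isIso_toHo_map _

instance isIso_toHo_map_fibRepHom (X : C) : IsIso ((toHo C).map (fibRepHom X)) :=
  isIso_toHo_map _

instance essSurj_cofibrantObject_toHo : (CofibrantObject.ι ⋙ toHo C).EssSurj :=
  Localization.essSurj _ (weakEquivalences (CofibrantObject C))

lemma exists_natTrans_app_toHo {E : Type*} [Category* E] {G H : Ho C ⥤ E}
    (τ : (CofibrantObject.ι ⋙ toHo C) ⋙ G ⟶ (CofibrantObject.ι ⋙ toHo C) ⋙ H) :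
    ∃ γ : G ⟶ H, ∀ A : CofibrantObject C, γ.app ((toHo C).obj A.obj) = τ.app A :=
  let Φ := Localization.whiskeringLeftFunctor' (CofibrantObject.ι ⋙ toHo C)
    (weakEquivalences (CofibrantObject C)) E
  ⟨Φ.preimage τ, congr_app (Φ.map_preimage τ)⟩

lemma exists_whiskerLeft_toHo_comp_eq {E : Type*} [Category* E] {G H : Ho C ⥤ E} {F : C ⥤ E}
    (α : toHo C ⋙ G ⟶ F) (hα : ∀ A : C, IsCofibrant A → IsIso (α.app A))
    (β : toHo C ⋙ H ⟶ F) : ∃ γ : H ⟶ G, Functor.whiskerLeft (toHo C) γ ≫ α = β := by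
  have : IsIso (Functor.whiskerLeft CofibrantObject.ι α) :=
    (NatTrans.isIso_iff_isIso_app _).2 (fun A => hα A.obj inferInstance)
  obtain ⟨γ, hγ⟩ := exists_natTrans_app_toHo (G := H) (H := G)
    (Functor.whiskerLeft CofibrantObject.ι β ≫ inv (Functor.whiskerLeft CofibrantObject.ι α))
  have fac (A : CofibrantObject C) :
      γ.app ((toHo C).obj A.obj) ≫ α.app A.obj = β.app A.obj := by
    have inv_comp := congr_app (IsIso.inv_hom_id (Functor.whiskerLeft CofibrantObject.ι α)) A
    have hγA := hγ A
    dsimp only [NatTrans.comp_app, Functor.whiskerLeft_app] at inv_comp hγA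
    rw [hγA, Category.assoc]
    exact (congrArg _ inv_comp).trans (Category.comp_id _)
  refine ⟨γ, ?_⟩
  ext X
  have nat_α := α.naturality (cofRepHom X)
  have nat_β := β.naturality (cofRepHom X)
  have facQ := fac (CofibrantObject.mk (cofRep X))
  dsimp at nat_α nat_β facQ ⊢
  rw [← cancel_epi (H.map ((toHo C).map (cofRepHom X))), nat_β, ← facQ,
    NatTrans.naturality_assoc, nat_α, Category.assoc]

lemma whiskerLeft_toHo_comp_injective {E : Type*} [Category* E] {G H : Ho C ⥤ E} {F : C ⥤ E}
    (α : toHo C ⋙ G ⟶ F) (hα : ∀ A : C, IsCofibrant A → IsIso (α.app A)) :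
    Function.Injective (fun γ : H ⟶ G => Functor.whiskerLeft (toHo C) γ ≫ α) := by
  intro γ γ' hγ
  refine Localization.natTrans_ext (CofibrantObject.ι ⋙ toHo C)
    (weakEquivalences (CofibrantObject C)) (fun A => ?_)
  have := hα A.obj inferInstance
  exact (cancel_mono (α.app A.obj)).1 (congr_app hγ A.obj)

lemma isLeftDerivedFunctor_of_isIso {E : Type*} [Category* E] {G : Ho C ⥤ E} {F : C ⥤ E}
    (α : toHo C ⋙ G ⟶ F) (hα : ∀ A : C, IsCofibrant A → IsIso (α.app A)) :
    G.IsLeftDerivedFunctor α (weakEquivalences C) := by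
  choose γ hγ using fun H : Functor.RightExtension (toHo C) F =>
    exists_whiskerLeft_toHo_comp_eq α hα H.hom
  exact ⟨⟨⟨IsTerminal.ofUniqueHom (fun H => CostructuredArrow.homMk (γ H) (hγ H))
    (fun H m => CostructuredArrow.hom_ext _ _ (whiskerLeft_toHo_comp_injective α hα
      ((CostructuredArrow.w m).trans (hγ H).symm)))⟩⟩⟩

lemma isRightDerivedFunctor_of_isIso {E : Type*} [Category* E] {G : Ho C ⥤ E} {U : C ⥤ E}
    (β : U ⟶ toHo C ⋙ G) (hβ : ∀ A : C, IsFibrant A → IsIso (β.app A)) :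
    G.IsRightDerivedFunctor β (weakEquivalences C) := by
  have hβ' (A : FibrantObject C) : IsIso (β.app A.obj) := hβ A.obj inferInstance
  refine LocalizerMorphism.Derives.isRightDerivedFunctor_of_isIso
    (Φ := FibrantObject.localizerMorphism C) (fun A B f hf => ?_) β hβ'
  have : WeakEquivalence f.hom := by
    rwa [← weakEquivalence_iff_of_objectProperty, weakEquivalence_iff]
  have : IsIso ((toHo C ⋙ G).map f.hom) := by
    have := isIso_toHo_map f.hom
    exact inferInstanceAs (IsIso (G.map ((toHo C).map f.hom)))
  have : IsIso (U.map f.hom ≫ β.app B.obj) := by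
    rw [β.naturality f.hom]
    infer_instance
  exact IsIso.of_isIso_comp_right (U.map f.hom) (β.app B.obj)

lemma toHo_map_comp_inv_cofRepHom {X Y : C} (f : X ⟶ Y) :
    (toHo C).map f ≫ inv ((toHo C).map (cofRepHom Y)) =
      inv ((toHo C).map (cofRepHom X)) ≫
        (toHo C).map (CofibrantObject.HoCat.resolutionMap f) := by
  rw [IsIso.comp_inv_eq, Category.assoc, ← Functor.map_comp,
    CofibrantObject.HoCat.resolutionMap_fac, Functor.map_comp, IsIso.inv_hom_id_assoc]

lemma inv_fibRepHom_comp_toHo_map {X Y : C} (f : X ⟶ Y) :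
    inv ((toHo C).map (fibRepHom X)) ≫ (toHo C).map f =
      (toHo C).map (FibrantObject.HoCat.resolutionMap f) ≫
        inv ((toHo C).map (fibRepHom Y)) := by
  rw [IsIso.inv_comp_eq, ← Category.assoc, IsIso.eq_comp_inv, ← Functor.map_comp,
    ← Functor.map_comp, FibrantObject.HoCat.resolutionMap_fac]

variable {D : Type u'} [Category.{v'} D] [ModelCategory D] {F : C ⥤ D} {U : D ⥤ C}
  {adj : F ⊣ U} (h : IsQuillenPair adj)

namespace IsQuillenPair

include h

/-- On cofibrant objects, the total left derived functor agrees with `F`. -/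
def leftDerivedIso : CofibrantObject.ι ⋙ toHo C ⋙ h.leftDerived ≅
    CofibrantObject.ι ⋙ F ⋙ toHo D :=
  Localization.fac _ h.left_inverts (CofibrantObject.ι ⋙ toHo C)

/-- On fibrant objects, the total right derived functor agrees with `U`. -/
def rightDerivedIso : FibrantObject.ι ⋙ toHo D ⋙ h.rightDerived ≅
    FibrantObject.ι ⋙ U ⋙ toHo C :=
  Localization.fac _ h.right_inverts (FibrantObject.ι ⋙ toHo D)

/-- The natural transformation that exhibits `h.leftDerived` as the left derived functor of `F`:
`LF X ≅ LF (Q X) ≅ F (Q X) ⟶ F X`. -/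
def leftDerivedCounit : toHo C ⋙ h.leftDerived ⟶ F ⋙ toHo D where
  app X := h.leftDerived.map (inv ((toHo C).map (cofRepHom X))) ≫
    h.leftDerivedIso.hom.app (CofibrantObject.mk (cofRep X)) ≫ (toHo D).map (F.map (cofRepHom X))
  naturality X Y f := by
    have nat_iso := h.leftDerivedIso.hom.naturality (X := CofibrantObject.mk (cofRep X))
      (Y := CofibrantObject.mk (cofRep Y)) ⟨CofibrantObject.HoCat.resolutionMap f⟩
    have nat_F := congrArg (fun g => (toHo D).map (F.map g))
      (CofibrantObject.HoCat.resolutionMap_fac f)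
    dsimp at nat_iso nat_F ⊢
    simp only [Functor.map_comp] at nat_F
    rw [← Functor.map_comp_assoc, toHo_map_comp_inv_cofRepHom, Functor.map_comp_assoc,
      reassoc_of% nat_iso, nat_F]
    simp only [Category.assoc]

/-- The natural transformation that exhibits `h.rightDerived` as the right derived functor of `U`:
`U X ⟶ U (R X) ≅ RU (R X) ≅ RU X`. -/
def rightDerivedUnit : U ⋙ toHo C ⟶ toHo D ⋙ h.rightDerived where
  app X := (toHo C).map (U.map (fibRepHom X)) ≫
    h.rightDerivedIso.inv.app (FibrantObject.mk (fibRep X)) ≫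
      h.rightDerived.map (inv ((toHo D).map (fibRepHom X)))
  naturality X Y f := by
    have nat_iso := h.rightDerivedIso.inv.naturality (X := FibrantObject.mk (fibRep X))
      (Y := FibrantObject.mk (fibRep Y)) ⟨FibrantObject.HoCat.resolutionMap f⟩
    have nat_U := congrArg (fun g => (toHo C).map (U.map g))
      (FibrantObject.HoCat.resolutionMap_fac f)
    dsimp at nat_iso nat_U ⊢
    simp only [Functor.map_comp] at nat_U
    simp only [Category.assoc]
    rw [← Functor.map_comp, inv_fibRepHom_comp_toHo_map, Functor.map_comp,
      ← reassoc_of% nat_iso, reassoc_of% nat_U]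

lemma leftDerivedCounit_app_of_isCofibrant (A : C) [IsCofibrant A] :
    h.leftDerivedCounit.app A = h.leftDerivedIso.hom.app (CofibrantObject.mk A) := by
  have nat_iso := h.leftDerivedIso.hom.naturality (X := CofibrantObject.mk (cofRep A))
    (Y := CofibrantObject.mk A) ⟨cofRepHom A⟩
  dsimp [leftDerivedCounit] at nat_iso ⊢
  rw [← nat_iso, ← Functor.map_comp_assoc, IsIso.inv_hom_id,
    CategoryTheory.Functor.map_id, Category.id_comp]

lemma rightDerivedUnit_app_of_isFibrant (B : D) [IsFibrant B] :
    h.rightDerivedUnit.app B = h.rightDerivedIso.inv.app (FibrantObject.mk B) := by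
  have nat_iso := h.rightDerivedIso.inv.naturality (X := FibrantObject.mk B)
    (Y := FibrantObject.mk (fibRep B)) ⟨fibRepHom B⟩
  dsimp [rightDerivedUnit] at nat_iso ⊢
  rw [reassoc_of% nat_iso, ← Functor.map_comp, IsIso.hom_inv_id,
    CategoryTheory.Functor.map_id, Category.comp_id]

instance isIso_leftDerivedCounit_app (A : C) [IsCofibrant A] :
    IsIso (h.leftDerivedCounit.app A) := by
  rw [leftDerivedCounit_app_of_isCofibrant]
  infer_instance

instance isIso_rightDerivedUnit_app (B : D) [IsFibrant B] :
    IsIso (h.rightDerivedUnit.app B) := by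
  rw [rightDerivedUnit_app_of_isFibrant]
  infer_instance

instance : h.leftDerived.IsLeftDerivedFunctor h.leftDerivedCounit (weakEquivalences C) :=
  isLeftDerivedFunctor_of_isIso _ (fun _ _ => inferInstance)

instance : h.rightDerived.IsRightDerivedFunctor h.rightDerivedUnit (weakEquivalences D) :=
  isRightDerivedFunctor_of_isIso _ (fun _ _ => inferInstance)

instance : (h.leftDerived ⋙ h.rightDerived).IsLeftDerivedFunctor
    ((Functor.associator _ _ _).inv ≫ Functor.whiskerRight h.leftDerivedCounit h.rightDerived)
    (weakEquivalences C) :=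
  isLeftDerivedFunctor_of_isIso _ (fun A _ => by dsimp; infer_instance)

instance : (h.rightDerived ⋙ h.leftDerived).IsRightDerivedFunctor
    (Functor.whiskerRight h.rightDerivedUnit h.leftDerived ≫ (Functor.associator _ _ _).hom)
    (weakEquivalences D) :=
  isRightDerivedFunctor_of_isIso _ (fun A _ => by dsimp; infer_instance)

/-- The adjunction between the total derived functors of a Quillen pair. -/
def derivedAdjunction : h.leftDerived ⊣ h.rightDerived :=
  adj.derived (weakEquivalences C) (weakEquivalences D) h.leftDerivedCounit h.rightDerivedUnit

lemma derivedAdjunction_unit_app (X : C) :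
    h.derivedAdjunction.unit.app ((toHo C).obj X) ≫
      h.rightDerived.map (h.leftDerivedCounit.app X) =
        (toHo C).map (adj.unit.app X) ≫ h.rightDerivedUnit.app (F.obj X) :=
  adj.derivedη_fac_app (weakEquivalences C) h.leftDerivedCounit h.rightDerivedUnit X

lemma derivedAdjunction_counit_app (Y : D) :
    h.leftDerived.map (h.rightDerivedUnit.app Y) ≫
      h.derivedAdjunction.counit.app ((toHo D).obj Y) =
        h.leftDerivedCounit.app (U.obj Y) ≫ (toHo D).map (adj.counit.app Y) :=
  adj.derivedε_fac_app (weakEquivalences D) h.leftDerivedCounit h.rightDerivedUnit Y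

end IsQuillenPair

end DerivedAdjunction

section LeftDerivedTriangulated

open ZeroObject

section

variable {C : Type u} [Category.{v} C] [ModelCategory C] [HasZeroObject C] [HasZeroMorphisms C]

/-- The morphism from the mapping cone of `i : A ⟶ E` to the suspension of `A` that collapses
`E`. -/
def mappingConeToSuspObj {A E : C} (i : A ⟶ E) : mappingCone i ⟶ suspObj A :=
  pushout.desc 0 (cokernel.π (coneι A)) (by rw [comp_zero, cokernel.condition])

lemma inl_mappingConeToSuspObj {A E : C} (i : A ⟶ E) :
    pushout.inl i (coneι A) ≫ mappingConeToSuspObj i = 0 :=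
  pushout.inl_desc _ _ _

lemma inr_mappingConeToSuspObj {A E : C} (i : A ⟶ E) :
    pushout.inr i (coneι A) ≫ mappingConeToSuspObj i = cokernel.π (coneι A) :=
  pushout.inr_desc _ _ _

lemma weakEquivalence_mappingConeToSuspObj {A E : C} (i : A ⟶ E) [IsCofibrant A] [Cofibration i]
    (hE : WeakEquivalence (0 : E ⟶ (0 : C))) : WeakEquivalence (mappingConeToSuspObj i) := by
  have : IsCofibrant E := isCofibrant_of_cofibration i
  have := weakEquivalence_cokernel_π (pushout.inl i (coneι A)) hE
  refine weakEquivalence_of_postcomp_of_fac (g := suspObjToCokernelInl i) (fg := cokernel.π _) ?_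
  apply pushout.hom_ext
  · rw [reassoc_of% inl_mappingConeToSuspObj, zero_comp, cokernel.condition]
  · rw [reassoc_of% inr_mappingConeToSuspObj, suspObjToCokernelInl, cokernel.π_desc]

lemma weakEquivalence_cokernel_map_of_contractible {A E T : C} (i : A ⟶ E) (t : A ⟶ T) (e : E ⟶ T)
    (he : i ≫ e = 𝟙 A ≫ t) [IsCofibrant A] [Cofibration i] [Cofibration t]
    (hE : WeakEquivalence (0 : E ⟶ (0 : C))) (hT : WeakEquivalence (0 : T ⟶ (0 : C))) :
    WeakEquivalence (cokernel.map i t (𝟙 A) e he) := by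
  let m : mappingCone i ⟶ mappingCone t :=
    pushout.desc (e ≫ pushout.inl _ _) (pushout.inr _ _) (by
      rw [reassoc_of% he, pushout.condition])
  have inl_m : pushout.inl _ _ ≫ m = e ≫ pushout.inl _ _ := pushout.inl_desc _ _ _
  have inr_m : pushout.inr _ _ ≫ m = pushout.inr _ _ := pushout.inr_desc _ _ _
  have m_toSuspObj : m ≫ mappingConeToSuspObj t = mappingConeToSuspObj i := by
    apply pushout.hom_ext
    · rw [reassoc_of% inl_m, inl_mappingConeToSuspObj, inl_mappingConeToSuspObj, comp_zero]
    · rw [reassoc_of% inr_m, inr_mappingConeToSuspObj, inr_mappingConeToSuspObj]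
  have m_toCokernel : mappingConeToCokernel i ≫ cokernel.map i t (𝟙 A) e he =
      m ≫ mappingConeToCokernel t := by
    apply pushout.hom_ext
    · rw [reassoc_of% inl_mappingConeToCokernel, reassoc_of% inl_m, inl_mappingConeToCokernel,
        cokernel.π_desc]
    · rw [reassoc_of% inr_mappingConeToCokernel, reassoc_of% inr_m, inr_mappingConeToCokernel,
        zero_comp]
  have := weakEquivalence_mappingConeToSuspObj i hE
  have := weakEquivalence_mappingConeToSuspObj t hT
  have : WeakEquivalence m := weakEquivalence_of_postcomp_of_fac m_toSuspObj
  exact weakEquivalence_of_precomp_of_fac m_toCokernel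

end

namespace IsQuillenPair

variable {C : Type u} [Category.{v} C] [ModelCategory C]
  {D : Type u'} [Category.{v'} D] [ModelCategory D]
  {F : C ⥤ D} {U : D ⥤ C} {adj : F ⊣ U} (h : IsQuillenPair adj)

include h

lemma isCofibrant_obj (A : C) [IsCofibrant A] : IsCofibrant (F.obj A) := by
  have := adj.leftAdjoint_preservesColimits
  have isInitial : IsInitial (F.obj (⊥_ C)) := IsInitial.isInitialObj F _ initialIsInitial
  have := h.cofibration_map (initial.to A) inferInstance
  have : IsIso (initial.to (F.obj (⊥_ C))) :=
    ⟨isInitial.to _, Subsingleton.elim _ _, isInitial.hom_ext _ _⟩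
  exact isCofibrant_of_cofibration (F.map (initial.to A))

/-- On a cofibrant object, the total left derived functor is given by `F`. -/
def leftDerivedObjIso (A : C) [IsCofibrant A] :
    h.leftDerived.obj ((toHo C).obj A) ≅ (toHo D).obj (F.obj A) :=
  asIso (h.leftDerivedCounit.app A)

lemma leftDerivedObjIso_naturality {A B : C} [IsCofibrant A] [IsCofibrant B] (f : A ⟶ B) :
    h.leftDerived.map ((toHo C).map f) ≫ (h.leftDerivedObjIso B).hom =
      (h.leftDerivedObjIso A).hom ≫ (toHo D).map (F.map f) :=
  h.leftDerivedCounit.naturality f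

variable [HasZeroObject D] [HasZeroMorphisms D]

/-- The suspension of `LF A` for a cofibrant object `A`. -/
def suspensionLeftDerivedObjIso (A : C) [IsCofibrant A] :
    (suspension D).obj (h.leftDerived.obj ((toHo C).obj A)) ≅ (toHo D).obj (suspObj (F.obj A)) :=
  have := h.isCofibrant_obj A
  (suspension D).mapIso (h.leftDerivedObjIso A) ≪≫ suspensionIso _

lemma suspensionLeftDerivedObjIso_naturality {A B : C} [IsCofibrant A] [IsCofibrant B]
    (f : A ⟶ B) :
    (suspension D).map (h.leftDerived.map ((toHo C).map f)) ≫
        (h.suspensionLeftDerivedObjIso B).hom =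
      (h.suspensionLeftDerivedObjIso A).hom ≫ (toHo D).map (suspMap (F.map f)) := by
  have := h.isCofibrant_obj A
  have nat := congrArg (suspension D).map (h.leftDerivedObjIso_naturality f)
  simp only [Functor.map_comp] at nat
  simp only [suspensionLeftDerivedObjIso, Iso.trans_hom, Functor.mapIso_hom, Category.assoc,
    reassoc_of% nat, suspensionIso_naturality]

variable [HasZeroObject C] [HasZeroMorphisms C]

lemma weakEquivalence_zero_obj {E : C} [IsCofibrant E] (hE : WeakEquivalence (0 : E ⟶ (0 : C))) :
    WeakEquivalence (0 : F.obj E ⟶ (0 : D)) := by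
  have := adj.leftAdjoint_preservesColimits
  have isZero : IsZero (F.obj (⊥_ C)) := (isZero_zero D).of_iso
    ((IsInitial.isInitialObj F _ initialIsInitial).uniqueUpToIso HasZeroObject.zeroIsInitial)
  have := weakEquivalence_initial_to hE
  have := h.weakEquivalence_map (initial.to E) inferInstance inferInstance
  have : IsIso (0 : F.obj (⊥_ C) ⟶ (0 : D)) :=
    ⟨0, isZero.eq_of_src _ _, (isZero_zero D).eq_of_src _ _⟩
  exact weakEquivalence_of_precomp_of_fac (f := F.map (initial.to E)) (fg := 0) comp_zero

lemma isCofiberSequence_map {X Y Z : Ho C} {f : X ⟶ Y} {g : Y ⟶ Z} (H : IsCofiberSequence f g) :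
    IsCofiberSequence (h.leftDerived.map f) (h.leftDerived.map g) := by
  have := adj.isLeftAdjoint
  obtain ⟨A, B, i, _, _, a, b, c, hf, hg⟩ := H
  have : IsCofibrant B := isCofibrant_of_cofibration i
  have := isCofibrant_cokernel i
  refine ⟨F.obj A, F.obj B, F.map i, h.isCofibrant_obj A, h.cofibration_map i inferInstance,
    h.leftDerived.mapIso a ≪≫ h.leftDerivedObjIso A,
    h.leftDerived.mapIso b ≪≫ h.leftDerivedObjIso B,
    h.leftDerived.mapIso c ≪≫ h.leftDerivedObjIso _ ≪≫
      (toHo D).mapIso (PreservesCokernel.iso F i), ?_, ?_⟩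
  · simp only [Iso.trans_hom, Functor.mapIso_hom, ← Functor.map_comp_assoc, hf, Category.assoc]
    simp only [Functor.map_comp, Category.assoc, leftDerivedObjIso_naturality]
  · simp only [Iso.trans_hom, Functor.mapIso_hom, ← Functor.map_comp_assoc, hg, Category.assoc]
    simp only [Functor.map_comp, Category.assoc, reassoc_of% h.leftDerivedObjIso_naturality,
      ← PreservesCokernel.π_iso_hom]

lemma exists_map_coneι_comp_eq (A : C) :
    ∃ e : F.obj (cone A) ⟶ cone (F.obj A), F.map (coneι A) ≫ e = coneι (F.obj A) :=
  have := h.cofibration_map (coneι A) inferInstance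
  exists_extension _ _ (isContractibleFibrant_cone _)

/-- A comparison of the image of the cone with the cone of the image, compatible with the
inclusions of `F.obj A`. -/
def coneComparison (A : C) : F.obj (cone A) ⟶ cone (F.obj A) :=
  (h.exists_map_coneι_comp_eq A).choose

lemma map_coneι_coneComparison (A : C) :
    F.map (coneι A) ≫ h.coneComparison A = coneι (F.obj A) :=
  (h.exists_map_coneι_comp_eq A).choose_spec

/-- The comparison of the image of the suspension with the suspension of the image that is induced
by `coneComparison`. -/
def suspComparison (A : C) : F.obj (suspObj A) ⟶ suspObj (F.obj A) :=
  have := adj.isLeftAdjoint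
  (PreservesCokernel.iso F (coneι A)).hom ≫ cokernel.map _ _ (𝟙 _) (h.coneComparison A)
    ((h.map_coneι_coneComparison A).trans (Category.id_comp _).symm)

lemma map_cokernelπ_suspComparison (A : C) :
    F.map (cokernel.π (coneι A)) ≫ h.suspComparison A =
      h.coneComparison A ≫ cokernel.π (coneι (F.obj A)) := by
  rw [suspComparison, PreservesCokernel.π_iso_hom_assoc, cokernel.π_desc]

lemma weakEquivalence_suspComparison (A : C) [IsCofibrant A] :
    WeakEquivalence (h.suspComparison A) := by
  have := h.isCofibrant_obj A
  have := h.cofibration_map (coneι A) inferInstance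
  have := weakEquivalence_cokernel_map_of_contractible (F.map (coneι A)) (coneι (F.obj A))
    (h.coneComparison A) ((h.map_coneι_coneComparison A).trans (Category.id_comp _).symm)
    (h.weakEquivalence_zero_obj (weakEquivalence_zero_cone A)) (weakEquivalence_zero_cone _)
  dsimp only [suspComparison]
  infer_instance

lemma toHo_map_suspComparison_naturality {A B : C} (f : A ⟶ B) :
    (toHo D).map (F.map (suspMap f)) ≫ (toHo D).map (h.suspComparison B) =
      (toHo D).map (h.suspComparison A) ≫ (toHo D).map (suspMap (F.map f)) := by
  have := adj.isLeftAdjoint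
  have := h.cofibration_map (coneι A) inferInstance
  have coneMap_coneComparison : F.map (coneι A) ≫ F.map (coneMap f) ≫ h.coneComparison B =
      F.map f ≫ coneι (F.obj B) := by
    rw [← Functor.map_comp_assoc, coneι_coneMap, Functor.map_comp_assoc,
      map_coneι_coneComparison]
  have coneComparison_coneMap : F.map (coneι A) ≫ h.coneComparison A ≫ coneMap (F.map f) =
      F.map f ≫ coneι (F.obj B) := by
    rw [reassoc_of% h.map_coneι_coneComparison, coneι_coneMap]
  have eq_left : F.map (suspMap f) ≫ h.suspComparison B =
      (PreservesCokernel.iso F (coneι A)).hom ≫ cokernel.map _ _ _ _ coneMap_coneComparison := by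
    rw [← cancel_epi (F.map (cokernel.π (coneι A))), ← Functor.map_comp_assoc, suspMap,
      cokernel.π_desc, Functor.map_comp_assoc, map_cokernelπ_suspComparison,
      PreservesCokernel.π_iso_hom_assoc, cokernel.π_desc, Category.assoc]
  have eq_right : h.suspComparison A ≫ suspMap (F.map f) =
      (PreservesCokernel.iso F (coneι A)).hom ≫ cokernel.map _ _ _ _ coneComparison_coneMap := by
    rw [← cancel_epi (F.map (cokernel.π (coneι A))), reassoc_of% h.map_cokernelπ_suspComparison,
      suspMap, cokernel.π_desc, PreservesCokernel.π_iso_hom_assoc, cokernel.π_desc,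
      Category.assoc]
  rw [← Functor.map_comp, ← Functor.map_comp, eq_left, eq_right, Functor.map_comp,
    Functor.map_comp, toHo_map_cokernel_map_eq _ _ (F.map f) (isContractibleFibrant_cone _) _ _
      coneMap_coneComparison coneComparison_coneMap]

/-- The total left derived functor on the suspension of a cofibrant object `A`. -/
def leftDerivedSuspensionObjIso (A : C) [IsCofibrant A] :
    h.leftDerived.obj ((suspension C).obj ((toHo C).obj A)) ≅ (toHo D).obj (suspObj (F.obj A)) :=
  have := isCofibrant_cokernel (coneι A)
  have := h.weakEquivalence_suspComparison A
  have := isIso_toHo_map (h.suspComparison A)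
  h.leftDerived.mapIso (suspensionIso A) ≪≫ h.leftDerivedObjIso _ ≪≫
    asIso ((toHo D).map (h.suspComparison A))

lemma leftDerivedSuspensionObjIso_naturality {A B : C} [IsCofibrant A] [IsCofibrant B]
    (f : A ⟶ B) :
    h.leftDerived.map ((suspension C).map ((toHo C).map f)) ≫
        (h.leftDerivedSuspensionObjIso B).hom =
      (h.leftDerivedSuspensionObjIso A).hom ≫ (toHo D).map (suspMap (F.map f)) := by
  have := isCofibrant_cokernel (coneι A)
  have := isCofibrant_cokernel (coneι B)
  have nat_suspension := congrArg h.leftDerived.map (suspensionIso_naturality f)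
  have nat_leftDerived := h.leftDerivedObjIso_naturality (suspMap f)
  simp only [Functor.map_comp] at nat_suspension
  simp only [leftDerivedSuspensionObjIso, Iso.trans_hom, Functor.mapIso_hom, asIso_hom,
    Category.assoc, reassoc_of% nat_suspension, reassoc_of% nat_leftDerived,
    h.toHo_map_suspComparison_naturality f]

lemma nonempty_leftDerivedSuspensionIso :
    Nonempty (suspension C ⋙ h.leftDerived ≅ h.leftDerived ⋙ suspension D) := by
  let τ : (CofibrantObject.ι ⋙ toHo C) ⋙ suspension C ⋙ h.leftDerived ⟶
      (CofibrantObject.ι ⋙ toHo C) ⋙ h.leftDerived ⋙ suspension D :=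
    { app A := (h.leftDerivedSuspensionObjIso A.obj).hom ≫
        (h.suspensionLeftDerivedObjIso A.obj).inv
      naturality A B f := by
        have nat_source := h.leftDerivedSuspensionObjIso_naturality f.hom
        have nat_target := h.suspensionLeftDerivedObjIso_naturality f.hom
        dsimp
        rw [← cancel_mono (h.suspensionLeftDerivedObjIso B.obj).hom]
        simp only [Category.assoc, Iso.inv_hom_id, Category.comp_id, nat_source, nat_target,
          Iso.inv_hom_id_assoc] }
  obtain ⟨γ, hγ⟩ := exists_natTrans_app_toHo τ
  have : IsIso γ := by
    rw [NatTrans.isIso_iff_isIso_app]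
    intro X
    obtain ⟨A, _, _, ⟨e⟩⟩ := exists_iso_toHo_obj X
    rw [NatTrans.isIso_app_iff_of_iso γ e, hγ (CofibrantObject.mk A)]
    dsimp only [τ]
    infer_instance
  exact ⟨asIso γ⟩

end IsQuillenPair

end LeftDerivedTriangulated

section Compactness

section

variable {T : Type u} [Category.{v} T] [Preadditive T]

open Classical in
lemma directSumToHom_of (X : T) {I : Type w} {A : I → T} (c : Cofan A) (i : I) (u : X ⟶ A i) :
    directSumToHom X c (DirectSum.of (fun i => (X ⟶ A i)) i u) = u ≫ c.inj i := by
  simp [directSumToHom, Preadditive.rightComp]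

lemma directSumToHom_comp (X : T) {I : Type w} {A : I → T} (c c' : Cofan A) (φ : c.pt ⟶ c'.pt)
    (hφ : ∀ i, c.inj i ≫ φ = c'.inj i) (x : ⨁ i, (X ⟶ A i)) :
    directSumToHom X c x ≫ φ = directSumToHom X c' x := by
  classical
  refine DFunLike.congr_fun (f := (Preadditive.rightComp X φ).comp (directSumToHom X c))
    (DirectSum.addHom_ext (fun i u => ?_)) x
  simp [directSumToHom_of, hφ, Preadditive.rightComp]

variable {T' : Type u'} [Category.{v'} T'] [Preadditive T']

lemma bijective_directSumToHom_iff {X : T} {X' : T'} {I : Type w} {A : I → T} {A' : I → T'}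
    (c : Cofan A) (c' : Cofan A') (e : ∀ i, (X ⟶ A i) ≃+ (X' ⟶ A' i))
    (e' : (X ⟶ c.pt) ≃+ (X' ⟶ c'.pt)) (h : ∀ i u, e' (u ≫ c.inj i) = e i u ≫ c'.inj i) :
    Function.Bijective (directSumToHom X c) ↔ Function.Bijective (directSumToHom X' c') := by
  classical
  refine bijective_iff_of_equiv (DFinsupp.mapRange.addEquiv e).toEquiv e'.toEquiv (fun x => ?_)
  refine DFunLike.congr_fun (f := e'.toAddMonoidHom.comp (directSumToHom X c))
    (g := (directSumToHom X' c').comp (DFinsupp.mapRange.addEquiv e).toAddMonoidHom)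
    (DirectSum.addHom_ext (fun i u => ?_)) x
  have mapRange_of : DFinsupp.mapRange.addEquiv e (DirectSum.of (fun i => (X ⟶ A i)) i u) =
      DirectSum.of (fun i => (X' ⟶ A' i)) i (e i u) :=
    DFinsupp.mapRange_single (f := fun i => e i) (hf := fun i => (e i).map_zero)
  simp [mapRange_of, directSumToHom_of, h]

lemma IsCompactObject.of_iso {X Y : T} (hX : IsCompactObject.{w} X) (e : X ≅ Y) :
    IsCompactObject.{w} Y := fun I A c hc =>
  (bijective_directSumToHom_iff c c
    (fun i => { e.homCongr (Iso.refl (A i)) with map_add' := by simp })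
    { e.homCongr (Iso.refl c.pt) with map_add' := by simp } (by simp)).1 (hX I A c hc)

variable {G : T ⥤ T'} {H : T' ⥤ T} (adj : G ⊣ H) [G.Additive]

include adj

lemma bijective_directSumToHom_obj_iff (X : T) {I : Type w} {A : I → T'} (c : Cofan A) :
    Function.Bijective (directSumToHom (G.obj X) c) ↔
      Function.Bijective (directSumToHom X
        (Cofan.mk (H.obj c.pt) (fun i => H.map (c.inj i)) : Cofan (fun i => H.obj (A i)))) :=
  bijective_directSumToHom_iff c _ (fun i => adj.homAddEquiv X (A i))
    (adj.homAddEquiv X c.pt) (fun _ u => adj.homEquiv_naturality_right u _)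

lemma IsCompactObject.obj_of_adjunction {X : T} (hX : IsCompactObject.{w} X)
    (hH : PreservesCoproducts.{w} H) : IsCompactObject.{w} (G.obj X) := fun I A c hc => by
  have := hH I
  rw [bijective_directSumToHom_obj_iff adj]
  exact hX I _ _ (Cofan.isColimitMapCoconeEquiv H A c (isColimitOfPreserves H hc))

lemma IsCompactObject.bijective_comp_sigmaComparison {X : T} (hX : IsCompactObject.{w} X)
    (hGX : IsCompactObject.{w} (G.obj X)) {I : Type w} (B : I → T') [HasCoproduct B]
    [HasCoproduct fun i => H.obj (B i)] :
    Function.Bijective (fun u : X ⟶ ∐ fun i => H.obj (B i) => u ≫ sigmaComparison H B) := by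
  let c := Cofan.mk (∐ B) (Sigma.ι B)
  let c' := Cofan.mk (∐ fun i => H.obj (B i)) (Sigma.ι _)
  have bij_target := (bijective_directSumToHom_obj_iff adj X c).1
    (hGX I B c (coproductIsCoproduct B))
  have comp_eq := funext (directSumToHom_comp X c'
    (Cofan.mk (H.obj c.pt) (fun i => H.map (c.inj i))) (sigmaComparison H B)
      (ι_comp_sigmaComparison H B))
  rw [← comp_eq] at bij_target
  exact (Function.Bijective.of_comp_iff _ (hX I _ c' (coproductIsCoproduct _))).1 bij_target

end

lemma additive_left_of_adjunction {T : Type u} [Category.{v} T] [Preadditive T]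
    {T' : Type u'} [Category.{v'} T'] [Preadditive T'] [HasCoproducts.{w} T']
    {G : T ⥤ T'} {H : T' ⥤ T} (adj : G ⊣ H) : G.Additive := by
  have := HasFiniteBiproducts.of_hasFiniteCoproducts (C := T')
  have := adj.isRightAdjoint
  have : H.Additive := Functor.additive_of_preserves_binary_products H
  exact adj.left_adjoint_additive

namespace IsHomotopicallyCompact

variable {C : Type u} [Category.{v} C] [ModelCategory C]

lemma of_iso {X Y : Ho C} (hX : IsHomotopicallyCompact.{w} X) (e : X ≅ Y) :
    IsHomotopicallyCompact.{w} Y :=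
  fun i => (hX i).of_iso e

variable [HasZeroObject C] [HasZeroMorphisms C] [IsStable C]

lemma obj_of_adjunction {D : Type u'} [Category.{v'} D] [ModelCategory D] [HasCoproducts.{w} D]
    {G : Ho C ⥤ Ho D} {H : Ho D ⥤ Ho C} (adj : G ⊣ H) {X : Ho C}
    (hX : IsHomotopicallyCompact.{w} X) (hH : PreservesCoproducts.{w} H) :
    IsHomotopicallyCompact.{w} (G.obj X) := fun _ => by
  obtain ⟨i⟩ := nonempty_preadditive C
  have := additive_left_of_adjunction.{w} adj
  exact (hX i).obj_of_adjunction adj hH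

lemma obj_of_equivalence [HasCoproducts.{w} C] (e : Ho C ≌ Ho C) {X : Ho C}
    (hX : IsHomotopicallyCompact.{w} X) : IsHomotopicallyCompact.{w} (e.functor.obj X) :=
  hX.obj_of_adjunction e.toAdjunction (fun _ => inferInstance)

end IsHomotopicallyCompact

end Compactness

section PreservesCoproducts

variable {C : Type u} [Category.{v} C] [ModelCategory C] [HasZeroObject C] [HasZeroMorphisms C]
  [IsStable C]
  {D : Type u'} [Category.{v'} D] [ModelCategory D] [HasZeroObject D] [HasZeroMorphisms D]
  [IsStable D]
  {F : C ⥤ D} {U : D ⥤ C} {adj : F ⊣ U} (h : IsQuillenPair adj)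

namespace IsQuillenPair

include h

lemma nonempty_suspensionIso (X : Ho C) : Nonempty
    (h.leftDerived.obj ((suspensionEquiv C).functor.obj X) ≅
      (suspensionEquiv D).functor.obj (h.leftDerived.obj X)) :=
  h.nonempty_leftDerivedSuspensionIso.map fun e => e.app X

lemma nonempty_desuspensionIso (X : Ho C) : Nonempty
    (h.leftDerived.obj ((suspensionEquiv C).inverse.obj X) ≅
      (suspensionEquiv D).inverse.obj (h.leftDerived.obj X)) := by
  obtain ⟨e⟩ := h.nonempty_suspensionIso ((suspensionEquiv C).inverse.obj X)
  exact ⟨(suspensionEquiv D).unitIso.app _ ≪≫ (suspensionEquiv D).inverse.mapIso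
    (e.symm ≪≫ h.leftDerived.mapIso ((suspensionEquiv C).counitIso.app X))⟩

variable [HasCoproducts.{w} C] [HasCoproducts.{w} D] {K : Set C}

lemma preservesCoproducts_rightDerived (hK : IsGeneratingSet.{w} K)
    (hKc : ∀ k ∈ K, IsHomotopicallyCompact.{w} ((toHo C).obj k))
    (hLF : ∀ k ∈ K, IsHomotopicallyCompact.{w} (h.leftDerived.obj ((toHo C).obj k))) :
    PreservesCoproducts.{w} h.rightDerived := fun I => by
  obtain ⟨_⟩ := nonempty_preadditive C
  obtain ⟨_⟩ := nonempty_preadditive D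
  have := additive_left_of_adjunction.{w} h.derivedAdjunction
  let S : ObjectProperty (Ho C) := fun X => IsHomotopicallyCompact.{w} X ∧
    IsHomotopicallyCompact.{w} (h.leftDerived.obj X)
  have suspension_mem (X : Ho C) (hX : S X) : S ((suspensionEquiv C).functor.obj X) :=
    ⟨hX.1.obj_of_equivalence _,
      (hX.2.obj_of_equivalence _).of_iso (h.nonempty_suspensionIso X).some.symm⟩
  have desuspension_mem (X : Ho C) (hX : S X) : S ((suspensionEquiv C).inverse.obj X) :=
    ⟨hX.1.obj_of_equivalence (suspensionEquiv C).symm,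
      (hX.2.obj_of_equivalence (suspensionEquiv D).symm).of_iso
        (h.nonempty_desuspensionIso X).some.symm⟩
  have (B : I → Ho D) : IsIso (sigmaComparison h.rightDerived B) :=
    hK.isIso_of_bijective_comp S suspension_mem desuspension_mem
      (fun k hk => ⟨hKc k hk, hLF k hk⟩) _ (fun X hX =>
        (hX.1 inferInstance).bijective_comp_sigmaComparison h.derivedAdjunction
          (hX.2 inferInstance) B)
  have (B : I → Ho D) : PreservesColimit (Discrete.functor B) h.rightDerived :=
    PreservesCoproduct.of_iso_comparison _ _
  exact preservesColimitsOfShape_of_discrete _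

theorem preservesCoproducts_rightDerived_iff (hK : IsGeneratingSet.{w} K)
    (hKc : ∀ k ∈ K, IsHomotopicallyCompact.{w} ((toHo C).obj k)) :
    PreservesCoproducts.{w} h.rightDerived ↔
      ∀ k ∈ K, IsHomotopicallyCompact.{w} (h.leftDerived.obj ((toHo C).obj k)) :=
  ⟨fun hRU k hk => (hKc k hk).obj_of_adjunction h.derivedAdjunction hRU,
    h.preservesCoproducts_rightDerived hK hKc⟩

end IsQuillenPair

end PreservesCoproducts

section QuillenEquivalence

section

variable {T : Type u} [Category.{v} T] {T' : Type u'} [Category.{v'} T']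
  {G : T ⥤ T'} {H : T' ⥤ T}

lemma isIso_unit_app_iff (adj : G ⊣ H) (X : T) :
    IsIso (adj.unit.app X) ↔
      ∀ S : T, Function.Bijective (G.map : (S ⟶ X) → (G.obj S ⟶ G.obj X)) := by
  rw [isIso_iff_yoneda_map_bijective]
  refine forall_congr' fun S => ?_
  rw [← Function.Bijective.of_comp_iff' (adj.homEquiv S (G.obj X)).bijective]
  refine iff_of_eq (congrArg _ (funext fun u => ?_))
  simp [Adjunction.homEquiv_unit]

lemma bijective_map_functor_obj_iff (e : T ≌ T) (e' : T' ≌ T')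
    (γ : e.functor ⋙ G ≅ G ⋙ e'.functor) (S X : T) :
    Function.Bijective (G.map : (e.functor.obj S ⟶ e.functor.obj X) → _) ↔
      Function.Bijective (G.map : (S ⟶ X) → (G.obj S ⟶ G.obj X)) := by
  refine (bijective_iff_of_equiv e.fullyFaithfulFunctor.homEquiv
    (e'.fullyFaithfulFunctor.homEquiv.trans ((γ.symm.app S).homCongr (γ.symm.app X)))
    (fun u => ?_)).symm
  have nat := γ.hom.naturality u
  dsimp at nat
  simp [Functor.FullyFaithful.homEquiv, Iso.homCongr, ← reassoc_of% nat]

lemma bijective_map_iff_of_iso (G : T ⥤ T') {S S' : T} (e : S ≅ S') (X : T) :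
    Function.Bijective (G.map : (S ⟶ X) → (G.obj S ⟶ G.obj X)) ↔
      Function.Bijective (G.map : (S' ⟶ X) → (G.obj S' ⟶ G.obj X)) :=
  bijective_iff_of_equiv (e.homCongr (Iso.refl _)) ((G.mapIso e).homCongr (Iso.refl _))
    (fun u => by simp [Iso.homCongr])

lemma isIso_unit_app_functor_obj_iff (adj : G ⊣ H) (e : T ≌ T) (e' : T' ≌ T')
    (γ : e.functor ⋙ G ≅ G ⋙ e'.functor) (X : T) :
    IsIso (adj.unit.app (e.functor.obj X)) ↔ IsIso (adj.unit.app X) := by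
  rw [isIso_unit_app_iff, isIso_unit_app_iff]
  refine ⟨fun bij S => (bijective_map_functor_obj_iff e e' γ S X).1 (bij _), fun bij S => ?_⟩
  exact (bijective_map_iff_of_iso G (e.counitIso.app S) _).1
    ((bijective_map_functor_obj_iff e e' γ _ X).2 (bij _))

lemma bijective_comp_counit_app (adj : G ⊣ H) [IsIso adj.unit] (S : T)
    (Y : T') :
    Function.Bijective (fun u : G.obj S ⟶ G.obj (H.obj Y) => u ≫ adj.counit.app Y) := by
  rw [← Function.Bijective.of_comp_iff _ ((isIso_unit_app_iff adj _).1 inferInstance S)]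
  have comp_eq : (fun u : G.obj S ⟶ G.obj (H.obj Y) => u ≫ adj.counit.app Y) ∘ G.map =
      (adj.homEquiv S Y).symm := funext fun u => (adj.homEquiv_counit _ _ u).symm
  rw [comp_eq]
  exact Equiv.bijective _

lemma IsWeakKernel.map_of_adjunction [HasZeroMorphisms T] [HasZeroMorphisms T'] (adj : G ⊣ H)
    [G.PreservesZeroMorphisms] [H.PreservesZeroMorphisms] {X Y Z : T'} {f : X ⟶ Y}
    {g : Y ⟶ Z} (h : IsWeakKernel f g) : IsWeakKernel (H.map f) (H.map g) where
  zero := by rw [← H.map_comp, h.zero, H.map_zero]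
  exists_lift {W} u hu := by
    obtain ⟨v, hv⟩ := h.exists_lift ((adj.homEquiv _ _).symm u) (by
      rw [← adj.homEquiv_naturality_right_symm, hu, Adjunction.homEquiv_counit, G.map_zero,
        zero_comp])
    exact ⟨adj.homEquiv _ _ v, by
      rw [← adj.homEquiv_naturality_right, hv, Equiv.apply_symm_apply]⟩

lemma isClosedUnderColimitsOfShape_isIso_app (J : Type*) [Category* J] {G₁ G₂ : T ⥤ T'}
    (τ : G₁ ⟶ G₂) [PreservesColimitsOfShape J G₁] [PreservesColimitsOfShape J G₂] :
    ObjectProperty.IsClosedUnderColimitsOfShape (fun X => IsIso (τ.app X)) J where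
  colimitsOfShape_le := by
    rintro X ⟨p⟩
    have : IsIso (Functor.whiskerLeft p.diag τ) :=
      (NatTrans.isIso_iff_isIso_app _).2 p.prop_diag_obj
    exact isIso_app_coconePt_of_preservesColimit p.diag τ _ p.isColimit

end

namespace IsQuillenPair

section

variable {C : Type u} [Category.{v} C] [ModelCategory C] {D : Type u'} [Category.{v'} D]
  [ModelCategory D] {F : C ⥤ D} {U : D ⥤ C} {adj : F ⊣ U} (h : IsQuillenPair adj)

include h

lemma isIso_derivedAdjunction_unit_app (A : C) (hA : WeakEquivalence (derivedUnit adj A)) :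
    IsIso (h.derivedAdjunction.unit.app ((toHo C).obj A)) := by
  rw [← NatTrans.isIso_app_iff_of_iso _ (asIso ((toHo C).map (cofRepHom A)))]
  have := isIso_toHo_map (derivedUnit adj A)
  have unit_eq : h.derivedAdjunction.unit.app ((toHo C).obj (cofRep A)) ≫
      h.rightDerived.map (h.leftDerivedCounit.app (cofRep A)) ≫
        h.rightDerived.map ((toHo D).map (fibRepHom (F.obj (cofRep A)))) =
      (toHo C).map (derivedUnit adj A) ≫
        h.rightDerivedUnit.app (fibRep (F.obj (cofRep A))) := by
    have nat := h.rightDerivedUnit.naturality (fibRepHom (F.obj (cofRep A)))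
    dsimp at nat
    rw [reassoc_of% h.derivedAdjunction_unit_app, derivedUnit, Functor.map_comp, Category.assoc,
      nat]
  exact (isIso_comp_right_iff _ (h.rightDerived.map (h.leftDerivedCounit.app (cofRep A)) ≫
    h.rightDerived.map ((toHo D).map (fibRepHom (F.obj (cofRep A)))))).1
      (unit_eq ▸ inferInstance)

lemma isIso_derivedAdjunction_counit_app (B : D) (hB : WeakEquivalence (derivedCounit adj B)) :
    IsIso (h.derivedAdjunction.counit.app ((toHo D).obj B)) := by
  rw [NatTrans.isIso_app_iff_of_iso _ (asIso ((toHo D).map (fibRepHom B)))]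
  have := isIso_toHo_map (derivedCounit adj B)
  have counit_eq : (h.leftDerived.map ((toHo C).map (cofRepHom (U.obj (fibRep B)))) ≫
      h.leftDerived.map (h.rightDerivedUnit.app (fibRep B))) ≫
        h.derivedAdjunction.counit.app ((toHo D).obj (fibRep B)) =
      h.leftDerivedCounit.app (cofRep (U.obj (fibRep B))) ≫
        (toHo D).map (derivedCounit adj B) := by
    have nat := h.leftDerivedCounit.naturality (cofRepHom (U.obj (fibRep B)))
    dsimp at nat
    rw [Category.assoc, derivedAdjunction_counit_app, derivedCounit, Functor.map_comp,
      reassoc_of% nat]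
  exact (isIso_comp_left_iff (h.leftDerived.map ((toHo C).map (cofRepHom (U.obj (fibRep B)))) ≫
    h.leftDerived.map (h.rightDerivedUnit.app (fibRep B))) _).1 (counit_eq ▸ inferInstance)

lemma isQuillenEquivalence_of_isIso [IsIso h.derivedAdjunction.unit]
    [IsIso h.derivedAdjunction.counit] : IsQuillenEquivalence adj where
  isQuillenPair := h
  weakEquivalence_iff X Y _ _ f := by
    have := h.derivedAdjunction.fullyFaithfulROfIsIsoCounit.full
    have := h.derivedAdjunction.fullyFaithfulROfIsIsoCounit.faithful
    have adjunct_eq : (toHo C).map (adj.homEquiv X Y f) ≫ h.rightDerivedUnit.app Y =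
        (h.derivedAdjunction.unit.app ((toHo C).obj X) ≫
          h.rightDerived.map (h.leftDerivedCounit.app X)) ≫
            h.rightDerived.map ((toHo D).map f) := by
      have nat := h.rightDerivedUnit.naturality f
      dsimp at nat
      rw [derivedAdjunction_unit_app, Adjunction.homEquiv_unit, Functor.map_comp,
        Category.assoc, Category.assoc, nat]
    rw [← isIso_toHo_map_iff, ← isIso_toHo_map_iff,
      ← isIso_comp_right_iff ((toHo C).map (adj.homEquiv X Y f)) (h.rightDerivedUnit.app Y),
      adjunct_eq, isIso_comp_left_iff]
    exact ⟨fun _ => inferInstance, fun _ => isIso_of_reflects_iso _ h.rightDerived⟩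

end

variable {C : Type u} [Category.{v} C] [ModelCategory C] [HasZeroObject C] [HasZeroMorphisms C]
  [IsStable C]
  {D : Type u'} [Category.{v'} D] [ModelCategory D] [HasZeroObject D] [HasZeroMorphisms D]
  [IsStable D]
  {F : C ⥤ D} {U : D ⥤ C} {adj : F ⊣ U} (h : IsQuillenPair adj)

include h

lemma isIso_unit_app_suspension_iff (X : Ho C) :
    IsIso (h.derivedAdjunction.unit.app ((suspension C).obj X)) ↔
      IsIso (h.derivedAdjunction.unit.app X) :=
  isIso_unit_app_functor_obj_iff h.derivedAdjunction (suspensionEquiv C) (suspensionEquiv D)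
    h.nonempty_leftDerivedSuspensionIso.some X

lemma isIso_unit_app_of_isCofiberSequence {X Y Z : Ho C} {f : X ⟶ Y} {g : Y ⟶ Z}
    (H : IsCofiberSequence f g) [hX : IsIso (h.derivedAdjunction.unit.app X)]
    [hY : IsIso (h.derivedAdjunction.unit.app Y)] : IsIso (h.derivedAdjunction.unit.app Z) := by
  obtain ⟨_⟩ := nonempty_preadditive C
  obtain ⟨_⟩ := nonempty_preadditive D
  have := h.derivedAdjunction.isLeftAdjoint
  have := h.derivedAdjunction.isRightAdjoint
  obtain ⟨δ, Hδ⟩ := H.rotate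
  obtain ⟨ε, Hε⟩ := Hδ.rotate
  have isWeakKernel_map {X Y Z : Ho C} {f : X ⟶ Y} {g : Y ⟶ Z} (H : IsCofiberSequence f g) :
      IsWeakKernel (h.rightDerived.map (h.leftDerived.map f))
        (h.rightDerived.map (h.leftDerived.map g)) :=
    (h.isCofiberSequence_map H).isWeakKernel.map_of_adjunction h.derivedAdjunction
  have nat {X Y : Ho C} (f : X ⟶ Y) := h.derivedAdjunction.unit.naturality f
  have := (h.isIso_unit_app_suspension_iff X).2 hX
  have := (h.isIso_unit_app_suspension_iff Y).2 hY
  exact isIso_of_isWeakKernel H.isWeakKernel Hδ.isWeakKernel Hε.isWeakKernel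
    (isWeakKernel_map H) (isWeakKernel_map Hδ) (isWeakKernel_map Hε)
    (nat f) (nat g) (nat δ) (nat ε)

lemma isLocalising_isIso_unit (hRU : PreservesCoproducts.{w} h.rightDerived) :
    IsLocalising.{w} (fun X : Ho C => IsIso (h.derivedAdjunction.unit.app X)) := by
  obtain ⟨_⟩ := nonempty_preadditive C
  obtain ⟨_⟩ := nonempty_preadditive D
  have := h.derivedAdjunction.isLeftAdjoint
  have := h.derivedAdjunction.isRightAdjoint
  refine .of_cofiber (fun X hX => ?_) h.isIso_unit_app_suspension_iff
    (fun f g H hX hY => h.isIso_unit_app_of_isCofiberSequence H) (fun I => ?_)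
  · have isZero := h.rightDerived.map_isZero (h.leftDerived.map_isZero hX)
    exact ⟨isZero.to_ _, hX.eq_of_src _ _, isZero.eq_of_src _ _⟩
  · have := hRU I
    have : PreservesColimitsOfShape (Discrete I) h.leftDerived :=
      h.derivedAdjunction.leftAdjoint_preservesColimits.preservesColimitsOfShape
    exact isClosedUnderColimitsOfShape_isIso_app (Discrete I) h.derivedAdjunction.unit

lemma isIso_derivedAdjunction_unit (hRU : PreservesCoproducts.{w} h.rightDerived)
    {K : Set C} (hK : IsGeneratingSet.{w} K)
    (hunit : ∀ k ∈ K, WeakEquivalence (derivedUnit adj k)) : IsIso h.derivedAdjunction.unit :=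
  (NatTrans.isIso_iff_isIso_app _).2 (hK _ (h.isLocalising_isIso_unit hRU)
    (fun k hk => h.isIso_derivedAdjunction_unit_app k (hunit k hk)))

lemma isIso_derivedAdjunction_counit [IsIso h.derivedAdjunction.unit] {L : Set D}
    (hL : IsGeneratingSet.{w} L) (hcounit : ∀ l ∈ L, WeakEquivalence (derivedCounit adj l)) :
    IsIso h.derivedAdjunction.counit := by
  rw [NatTrans.isIso_iff_isIso_app]
  refine fun Y => hL.isIso_of_bijective_comp h.leftDerived.essImage ?_ ?_ (fun l hl => ?_) _ ?_
  · rintro X ⟨S, ⟨e⟩⟩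
    exact ⟨_, ⟨(h.nonempty_suspensionIso S).some ≪≫ (suspensionEquiv D).functor.mapIso e⟩⟩
  · rintro X ⟨S, ⟨e⟩⟩
    exact ⟨_, ⟨(h.nonempty_desuspensionIso S).some ≪≫ (suspensionEquiv D).inverse.mapIso e⟩⟩
  · have := h.isIso_derivedAdjunction_counit_app l (hcounit l hl)
    exact ⟨_, ⟨asIso (h.derivedAdjunction.counit.app ((toHo D).obj l))⟩⟩
  · rintro X ⟨S, ⟨e⟩⟩
    exact (bijective_comp_iff_of_iso e _).1 (bijective_comp_counit_app h.derivedAdjunction S Y)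

theorem isQuillenEquivalence (hRU : PreservesCoproducts.{w} h.rightDerived)
    {K : Set C} (hK : IsGeneratingSet.{w} K) {L : Set D} (hL : IsGeneratingSet.{w} L)
    (hunit : ∀ k ∈ K, WeakEquivalence (derivedUnit adj k))
    (hcounit : ∀ l ∈ L, WeakEquivalence (derivedCounit adj l)) : IsQuillenEquivalence adj :=
  have := h.isIso_derivedAdjunction_unit hRU hK hunit
  have := h.isIso_derivedAdjunction_counit hL hcounit
  h.isQuillenEquivalence_of_isIso

end IsQuillenPair

end QuillenEquivalence

end StableModel

end

theorem mainTheorem10_general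
    {C : Type u} [Category.{v} C] [ModelCategory C] [HasZeroObject C] [HasZeroMorphisms C]
    [HasCoproducts.{w} C] [StableModel.IsStable C]
    {D : Type u'} [Category.{v'} D] [ModelCategory D] [HasZeroObject D] [HasZeroMorphisms D]
    [HasCoproducts.{w} D] [StableModel.IsStable D]
    {F : C ⥤ D} {U : D ⥤ C} (adj : F ⊣ U) (h : StableModel.IsQuillenPair adj)
    (K : Set C) (hK : StableModel.IsGeneratingSet.{w} K)
    (L : Set D) (hL : StableModel.IsGeneratingSet.{w} L) :
    ((∀ k ∈ K, StableModel.IsHomotopicallyCompact.{w} ((StableModel.toHo C).obj k)) →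
      (StableModel.PreservesCoproducts.{w} h.rightDerived ↔
        ∀ k ∈ K, StableModel.IsHomotopicallyCompact.{w}
          (h.leftDerived.obj ((StableModel.toHo C).obj k)))) ∧
    (StableModel.PreservesCoproducts.{w} h.rightDerived →
      (∀ k ∈ K, WeakEquivalence (StableModel.derivedUnit adj k)) →
      (∀ l ∈ L, WeakEquivalence (StableModel.derivedCounit adj l)) →
      StableModel.IsQuillenEquivalence adj) :=
  ⟨fun hKc => h.preservesCoproducts_rightDerived_iff hK hKc,
    fun hRU hunit hcounit => h.isQuillenEquivalence hRU hK hL hunit hcounit⟩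

theorem mainTheorem10
    {C : Type u} [Category.{v} C] [ModelCategory C] [HasZeroObject C] [HasZeroMorphisms C]
    [HasCoproducts.{w} C] [StableModel.IsStable C]
    {D : Type u'} [Category.{v'} D] [ModelCategory D] [HasZeroObject D] [HasZeroMorphisms D]
    [HasCoproducts.{w} D] [StableModel.IsStable D]
    {F : C ⥤ D} {U : D ⥤ C} (adj : F ⊣ U) (h : StableModel.IsQuillenPair adj)
    (K : Set C) (hK : StableModel.IsGeneratingSet.{w} K)
    (hKc : ∀ k ∈ K, StableModel.IsHomotopicallyCompact.{w} ((StableModel.toHo C).obj k))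
    (L : Set D) (hL : StableModel.IsGeneratingSet.{w} L)
    (hLc : ∀ l ∈ L, StableModel.IsHomotopicallyCompact.{w} ((StableModel.toHo D).obj l)) :
    (StableModel.PreservesCoproducts.{w} h.rightDerived ↔
      ∀ k ∈ K, StableModel.IsHomotopicallyCompact.{w}
        (h.leftDerived.obj ((StableModel.toHo C).obj k))) ∧
    (StableModel.PreservesCoproducts.{w} h.rightDerived →
      (∀ k ∈ K, WeakEquivalence (StableModel.derivedUnit adj k)) →
      (∀ l ∈ L, WeakEquivalence (StableModel.derivedCounit adj l)) →
      StableModel.IsQuillenEquivalence adj) :=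
  (mainTheorem10_general adj h K hK L hL).imp_left (fun compact_iff => compact_iff hKc)
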